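/- All quantum systems are finite-dimensional. A quantum channel is a map $\mathcal N(\rho)=\sum_k K_k\rho K_k^\dagger$ from operators on $A'$ to operators on $B$ with $\sum_k K_k^\dagger K_k=I$. An isometric extension of $\mathcal N$ is an isometry $U=U_{\mathcal N}^{A'\to BE}$ with $\mathcal N(\rho)=\mathrm{Tr}_E\{U\rho U^\dagger\}$ for all $\rho$; the corresponding complementary channel is $\mathcal N^c(\rho)=\mathrm{Tr}_B\{U\rho U^\dagger\}$. The channel $\mathcal N$ is degradable if there are an isometric extension of $\mathcal N$, with complementary channel $\mathcal N^c$, and a channel $\mathcal D$ from $B$ to the environment of that extension such that $\mathcal D(\mathcal N(\rho))=\mathcal N^c(\rho)$ for every density operator $\rho$. Write $H(A)_\rho=-\mathrm{Tr}\{\rho^A\log_2\rho^A\}$, $H(A|C)=H(AC)-H(C)$, $I(A;B)=H(A)+H(B)-H(AB)$ and $I(A;B|C)=H(AC)+H(BC)-H(C)-H(ABC)$. Let $\mathcal N$ be a degradable channel with non-zero input space, let $U$ be any isometric extension of $\mathcal N$, and let $\lambda,\mu\ge 0$. The private dynamic capacity formula of $\mathcal N$ is $$P_{\lambda,\mu}(\mathcal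 N)=\max_{\sigma}\; I(YX;B)_\sigma+\lambda\left[I(Y;B|X)_\sigma-I(Y;E|X)_\sigma\right]+\mu\left[I(YX;B)_\sigma-I(Y;E|X)_\sigma\right],$$ where the maximum is over all states $$\sigma^{XYBE}=\sum_{x,y}p_{X,Y}(x,y)\,|x\rangle\langle x|^X\otimes|y\rangle\langle y|^Y\otimes U\rho_{x,y}^{A'}U^\dagger$$ with finite (arbitrarily large) alphabets for $X$ and $Y$, a joint probability distribution $p_{X,Y}$, and arbitrary (possibly mixed) density operators $\rho_{x,y}$ on $A'$. Then $$P_{\lambda,\mu}(\mathcal N)=g_{\lambda,\mu}(\mathcal N),$$ where $$g_{\lambda,\mu}(\mathcal N)=\max_{\omega}\; I(YX;B)_\omega+\lambda\left[H(B|X)_\omega-H(E|X)_\omega\right]+\mu\left[H(B)_\omega-H(E|X)_\omega\right]$$ and the maximum is over all states $$\omega^{XYBE}=\sum_{x,y}p_{X,Y}(x,y)\,|x\rangle\langle x|^X\otimes|y\rangle\langle y|^Y\otimes U\psi_{x,y}^{A'}U^\dagger$$ with finite (arbitrarily large) alphabets, a joint probability distribution $p_{X,Y}$, and pure states $\psi_{x,y}$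 on $A'$. In particular both maxima are attained. -/

import Mathlib

open scoped Kronecker ComplexOrder

noncomputable section

namespace PrivateDynamic

/-! Finite-dimensional quantum systems: a system with a basis indexed by the finite type `a` has
state space `a → ℂ`, and its operators are the matrices `Matrix a a ℂ`. -/

/-- Density operators: positive semidefinite matrices of unit trace. -/
def IsDensity {a : Type*} [Fintype a] (ρ : Matrix a a ℂ) : Prop :=
  ρ.PosSemidef ∧ ρ.trace = 1

/-- Pure states: the rank-one projections `|ψ⟩⟨ψ|` onto unit vectors `ψ`. -/
def IsPure {a : Type*} [Fintype a] (ρ : Matrix a a ℂ) : Prop :=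
  ∃ ψ : a → ℂ, star ψ ⬝ᵥ ψ = 1 ∧ ρ = Matrix.vecMulVec ψ (star ψ)

/-- Quantum channels (completely positive trace-preserving maps), in Kraus form:
`N ρ = ∑ k, K k * ρ * (K k)ᴴ` with `∑ k, (K k)ᴴ * K k = 1`. -/
def IsChannel {a b : Type*} [Fintype a] [DecidableEq a] [Fintype b]
    (N : Matrix a a ℂ →ₗ[ℂ] Matrix b b ℂ) : Prop :=
  ∃ (n : ℕ) (K : Fin n → Matrix b a ℂ),
    (∑ k, (K k).conjTranspose * K k = 1) ∧ ∀ ρ, N ρ = ∑ k, K k * ρ * (K k).conjTranspose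

/-- Partial trace over the second tensor factor. -/
def traceSnd {α β : Type*} [Fintype β] (M : Matrix (α × β) (α × β) ℂ) : Matrix α α ℂ :=
  Matrix.of fun i j => ∑ k, M (i, k) (j, k)

/-- Partial trace over the first tensor factor. -/
def traceFst {α β : Type*} [Fintype α] (M : Matrix (α × β) (α × β) ℂ) : Matrix β β ℂ :=
  Matrix.of fun i j => ∑ k, M (k, i) (k, j)

/-- `U`, a linear map from system `a` to the composite system `b × e`, is an isometric extension of
`N` with environment `e`: it is an isometry, and tracing out the environment gives back `N`. -/
def IsIsometricExtension {a b e : Type*} [Fintype a] [DecidableEq a] [Fintype b] [Fintype e]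
    (U : Matrix (b × e) a ℂ) (N : Matrix a a ℂ →ₗ[ℂ] Matrix b b ℂ) : Prop :=
  U.conjTranspose * U = 1 ∧ ∀ ρ, N ρ = traceSnd (U * ρ * U.conjTranspose)

/-- Action on operators of the complementary channel of the channel with isometric extension `U`:
the output `b` is traced out instead of the environment `e`. -/
def complementary {a b e : Type*} [Fintype a] [Fintype b]
    (U : Matrix (b × e) a ℂ) (ρ : Matrix a a ℂ) : Matrix e e ℂ :=
  traceFst (U * ρ * U.conjTranspose)

/-- `N` is degradable: some channel `D` from the output to the environment (the degrading map)
satisfies `D (N ρ) = Nᶜ ρ` for every state `ρ`, where `Nᶜ` is the complementary channel belonging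
to an isometric extension of `N`. -/
def IsDegradable {a b : Type*} [Fintype a] [DecidableEq a] [Fintype b] [DecidableEq b]
    (N : Matrix a a ℂ →ₗ[ℂ] Matrix b b ℂ) : Prop :=
  ∃ (n : ℕ) (V : Matrix (b × Fin n) a ℂ), IsIsometricExtension V N ∧
    ∃ D : Matrix b b ℂ →ₗ[ℂ] Matrix (Fin n) (Fin n) ℂ, IsChannel D ∧
      ∀ ρ, IsDensity ρ → D (N ρ) = complementary V ρ

/-- The von Neumann entropy `H(ρ) = -Tr (ρ log₂ ρ)`; `log₂ ρ` is taken in the functional calculus,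
where the value of the logarithm at `0` is `0`, so that `0 log₂ 0 = 0`. -/
def entropy {a : Type*} [Fintype a] [DecidableEq a] (ρ : Matrix a a ℂ) : ℝ :=
  -(ρ * cfc (Real.logb 2) ρ).trace.re

section Information

variable {X Y B E : Type*} [Fintype X] [DecidableEq X] [Fintype Y] [DecidableEq Y]
  [Fintype B] [DecidableEq B] [Fintype E] [DecidableEq E]

/-! Reduced states of an operator on the four-party system `X Y B E`. -/

/-- Reduced state on `X Y B`. -/
def redXYB (σ : Matrix (X × Y × B × E) (X × Y × B × E) ℂ) : Matrix (X × Y × B) (X × Y × B) ℂ :=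
  Matrix.of fun (x, y, b) (x', y', b') => ∑ e, σ (x, y, b, e) (x', y', b', e)

/-- Reduced state on `X Y E`. -/
def redXYE (σ : Matrix (X × Y × B × E) (X × Y × B × E) ℂ) : Matrix (X × Y × E) (X × Y × E) ℂ :=
  Matrix.of fun (x, y, e) (x', y', e') => ∑ b, σ (x, y, b, e) (x', y', b, e')

/-- Reduced state on `X Y`. -/
def redXY (σ : Matrix (X × Y × B × E) (X × Y × B × E) ℂ) : Matrix (X × Y) (X × Y) ℂ :=
  Matrix.of fun (x, y) (x', y') => ∑ b, ∑ e, σ (x, y, b, e) (x', y', b, e)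

/-- Reduced state on `X B`. -/
def redXB (σ : Matrix (X × Y × B × E) (X × Y × B × E) ℂ) : Matrix (X × B) (X × B) ℂ :=
  Matrix.of fun (x, b) (x', b') => ∑ y, ∑ e, σ (x, y, b, e) (x', y, b', e)

/-- Reduced state on `X E`. -/
def redXE (σ : Matrix (X × Y × B × E) (X × Y × B × E) ℂ) : Matrix (X × E) (X × E) ℂ :=
  Matrix.of fun (x, e) (x', e') => ∑ y, ∑ b, σ (x, y, b, e) (x', y, b, e')

/-- Reduced state on `X`. -/
def redX (σ : Matrix (X × Y × B × E) (X × Y × B × E) ℂ) : Matrix X X ℂ :=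
  Matrix.of fun x x' => ∑ y, ∑ b, ∑ e, σ (x, y, b, e) (x', y, b, e)

/-- Reduced state on `B`. -/
def redB (σ : Matrix (X × Y × B × E) (X × Y × B × E) ℂ) : Matrix B B ℂ :=
  Matrix.of fun b b' => ∑ x, ∑ y, ∑ e, σ (x, y, b, e) (x, y, b', e)

/-- `H(B)`. -/
def entB (σ : Matrix (X × Y × B × E) (X × Y × B × E) ℂ) : ℝ :=
  entropy (redB σ)

/-- `H(B|X) = H(XB) - H(X)`. -/
def condEntBX (σ : Matrix (X × Y × B × E) (X × Y × B × E) ℂ) : ℝ :=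
  entropy (redXB σ) - entropy (redX σ)

/-- `H(E|X) = H(XE) - H(X)`. -/
def condEntEX (σ : Matrix (X × Y × B × E) (X × Y × B × E) ℂ) : ℝ :=
  entropy (redXE σ) - entropy (redX σ)

/-- `I(YX;B) = H(YX) + H(B) - H(YXB)`. -/
def mutInfoYXB (σ : Matrix (X × Y × B × E) (X × Y × B × E) ℂ) : ℝ :=
  entropy (redXY σ) + entropy (redB σ) - entropy (redXYB σ)

/-- `I(Y;B|X) = H(YX) + H(BX) - H(X) - H(YBX)`. -/
def condMutInfoYBX (σ : Matrix (X × Y × B × E) (X × Y × B × E) ℂ) : ℝ :=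
  entropy (redXY σ) + entropy (redXB σ) - entropy (redX σ) - entropy (redXYB σ)

/-- `I(Y;E|X) = H(YX) + H(EX) - H(X) - H(YEX)`. -/
def condMutInfoYEX (σ : Matrix (X × Y × B × E) (X × Y × B × E) ℂ) : ℝ :=
  entropy (redXY σ) + entropy (redXE σ) - entropy (redX σ) - entropy (redXYE σ)

/-- The objective of the private dynamic capacity formula:
`I(YX;B) + l [I(Y;B|X) - I(Y;E|X)] + m [I(YX;B) - I(Y;E|X)]`. -/
def privateObjective (l m : ℝ) (σ : Matrix (X × Y × B × E) (X × Y × B × E) ℂ) : ℝ :=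
  mutInfoYXB σ + l * (condMutInfoYBX σ - condMutInfoYEX σ)
    + m * (mutInfoYXB σ - condMutInfoYEX σ)

/-- The objective of the simplified formula:
`I(YX;B) + l [H(B|X) - H(E|X)] + m [H(B) - H(E|X)]`. -/
def pureObjective (l m : ℝ) (σ : Matrix (X × Y × B × E) (X × Y × B × E) ℂ) : ℝ :=
  mutInfoYXB σ + l * (condEntBX σ - condEntEX σ) + m * (entB σ - condEntEX σ)

end Information

/-- `p` is a joint probability distribution on `X × Y`. -/
def IsJointDistribution {X Y : Type*} [Fintype X] [Fintype Y] (p : X → Y → ℝ) : Prop :=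
  (∀ x y, 0 ≤ p x y) ∧ ∑ x, ∑ y, p x y = 1

/-- The classical-quantum state
`∑ x y, p x y |x⟩⟨x| ⊗ |y⟩⟨y| ⊗ U (ρ x y) Uᴴ` on the systems `X Y B E`. -/
def cqState {X Y a b e : Type*} [Fintype X] [DecidableEq X] [Fintype Y] [DecidableEq Y]
    [Fintype a] (U : Matrix (b × e) a ℂ) (p : X → Y → ℝ) (ρ : X → Y → Matrix a a ℂ) :
    Matrix (X × Y × b × e) (X × Y × b × e) ℂ :=
  ∑ x, ∑ y, (p x y : ℂ) • ((Matrix.single x x (1 : ℂ)) ⊗ₖ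
    ((Matrix.single y y (1 : ℂ)) ⊗ₖ (U * ρ x y * U.conjTranspose)))

section Formulas

variable {a b e : Type*} [Fintype a] [Fintype b] [DecidableEq b] [Fintype e] [DecidableEq e]

/-- The values of the private objective on the states `σ^{XYBE}`, over all finite alphabets for
`X` and `Y`, all joint distributions and all (possibly mixed) input states. -/
def privateValues (U : Matrix (b × e) a ℂ) (l m : ℝ) : Set ℝ :=
  {v | ∃ (r s : ℕ) (p : Fin r → Fin s → ℝ) (ρ : Fin r → Fin s → Matrix a a ℂ),
    IsJointDistribution p ∧ (∀ x y, IsDensity (ρ x y)) ∧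
      v = privateObjective l m (cqState U p ρ)}

/-- The values of the simplified objective on the states `ω^{XYBE}`, over all finite alphabets for
`X` and `Y`, all joint distributions and all pure input states. -/
def pureValues (U : Matrix (b × e) a ℂ) (l m : ℝ) : Set ℝ :=
  {v | ∃ (r s : ℕ) (p : Fin r → Fin s → ℝ) (ψ : Fin r → Fin s → Matrix a a ℂ),
    IsJointDistribution p ∧ (∀ x y, IsPure (ψ x y)) ∧
      v = pureObjective l m (cqState U p ψ)}

/-- The private dynamic capacity formula `P_{l,m}` of the channel with isometric extension `U`.
The theorem asserts that this supremum is a maximum. -/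
def privateDynamicFormula (U : Matrix (b × e) a ℂ) (l m : ℝ) : ℝ :=
  sSup (privateValues U l m)

/-- The simplified formula `g_{l,m}` of the channel with isometric extension `U`.
The theorem asserts that this supremum is a maximum. -/
def pureFormula (U : Matrix (b × e) a ℂ) (l m : ℝ) : ℝ :=
  sSup (pureValues U l m)

end Formulas

end PrivateDynamic

end

open scoped Kronecker ComplexOrder
open Matrix

set_option linter.unusedSectionVars false

/-! Expanding the mutual informations shows that the private objective equals the simplified one
minus `(l + m) [H(B|XY) - H(E|XY)]` (`privateObjective_cqState`). For pure inputs the bracket is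
zero, because the two marginals of a pure state of `BE` have the same nonzero spectrum. So every
simplified value is a private value.

For mixed inputs the bracket is nonnegative by degradability (`entropy_complementary_le`). Write the
input as a mixture of pure states. Degrading the output ensemble gives the environment ensemble, so
the Holevo quantity cannot increase; the entropies of the individual members agree and cancel,
leaving `H(E) ≤ H(B)`. The degrading map may belong to another isometric extension, but the
environment entropy depends only on the channel (`entropy_complementary_congr`). Hence the bracket
may be dropped, and each mixed input split into eigenstates with the eigenvector label appended to
`Y`. This keeps all averages over `Y` and, by concavity of the entropy, can only lower `H(B|XY)`, so
it can only raise the simplified objective (`exists_pureValue_ge`).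

Data processing (`holevo_krausMap_le`) follows from monotonicity of the relative entropy. The latter
is an integral over `u` of quadratic divergences, each a supremum of concave forms `varForm`; the
Kadison–Schwarz inequality compares these forms before and after a channel. Concavity of the entropy
is the special case where the channel is the trace.

For attainment with unbounded alphabets, the simplified objective is a continuous function `gain` of
a point in a twice-formed convex hull: the inner hull averages over `Y` for fixed `X`, the outer one
over `X`. By Carathéodory both hulls are compact, so a maximum exists. -/

namespace PrivateDynamic

/-- The scalar entropy function `-x log₂ x`. -/
noncomputable def eta (x : ℝ) : ℝ := -(x * Real.logb 2 x)

/-! ### The von Neumann entropy as a function of the spectrum -/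

section Entropy

variable {a b : Type*} [Fintype a] [DecidableEq a] [Fintype b] [DecidableEq b]

lemma eigen_decomp {A : Matrix a a ℂ} (hA : A.IsHermitian) :
    A = (hA.eigenvectorUnitary : Matrix a a ℂ) * diagonal (fun i => (hA.eigenvalues i : ℂ)) *
      (hA.eigenvectorUnitary : Matrix a a ℂ)ᴴ := by
  conv_lhs => rw [hA.spectral_theorem, Unitary.conjStarAlgAut_apply]
  rfl

lemma cfc_decomp {A : Matrix a a ℂ} (hA : A.IsHermitian) (f : ℝ → ℝ) :
    cfc f A = (hA.eigenvectorUnitary : Matrix a a ℂ) *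
      diagonal (fun i => (f (hA.eigenvalues i) : ℂ)) *
      (hA.eigenvectorUnitary : Matrix a a ℂ)ᴴ := by
  rw [hA.cfc_eq, IsHermitian.cfc, Unitary.conjStarAlgAut_apply]
  rfl

lemma eigenvectorUnitary_conjTranspose_mul {A : Matrix a a ℂ} (hA : A.IsHermitian) :
    (hA.eigenvectorUnitary : Matrix a a ℂ)ᴴ * (hA.eigenvectorUnitary : Matrix a a ℂ) = 1 :=
  Unitary.coe_star_mul_self hA.eigenvectorUnitary

lemma eigenvectorUnitary_mul_conjTranspose {A : Matrix a a ℂ} (hA : A.IsHermitian) :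
    (hA.eigenvectorUnitary : Matrix a a ℂ) * (hA.eigenvectorUnitary : Matrix a a ℂ)ᴴ = 1 :=
  Unitary.coe_mul_star_self hA.eigenvectorUnitary

lemma mul_cfc_logb {A : Matrix a a ℂ} (hA : A.IsHermitian) :
    A * cfc (Real.logb 2) A = -cfc eta A := by
  have h := eigenvectorUnitary_conjTranspose_mul hA
  conv_lhs => enter [1]; rw [eigen_decomp hA]
  rw [cfc_decomp hA, cfc_decomp hA]
  simp only [Matrix.mul_assoc]
  rw [← Matrix.mul_assoc _ _ (diagonal _ * _), h, Matrix.one_mul,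
    ← Matrix.mul_assoc (diagonal _) (diagonal _), diagonal_mul_diagonal,
    ← Matrix.mul_neg, ← Matrix.neg_mul, diagonal_neg]
  congr 3
  ext i
  simp [eta]

lemma entropy_eq_trace_cfc {A : Matrix a a ℂ} (hA : A.IsHermitian) :
    entropy A = (cfc eta A).trace.re := by
  rw [entropy, mul_cfc_logb hA]; simp

lemma entropy_eq_sum {A : Matrix a a ℂ} (hA : A.IsHermitian) :
    entropy A = ∑ i, eta (hA.eigenvalues i) := by
  rw [entropy_eq_trace_cfc hA, cfc_decomp hA, Matrix.trace_mul_comm, ← Matrix.mul_assoc,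
    eigenvectorUnitary_conjTranspose_mul hA, Matrix.one_mul, trace_diagonal]
  simp

/-- Roots of the characteristic polynomial involve no eigenbasis and no index type, so invariance of
the entropy reduces to polynomial identities. -/
lemma entropy_eq_roots {A : Matrix a a ℂ} (hA : A.IsHermitian) :
    entropy A = (A.charpoly.roots.map (fun z => eta z.re)).sum := by
  rw [entropy_eq_sum hA, hA.roots_charpoly_eq_eigenvalues, Multiset.map_map]
  rfl

lemma entropy_congr_charpoly {A : Matrix a a ℂ} {B : Matrix b b ℂ} (hA : A.IsHermitian)
    (hB : B.IsHermitian) (h : A.charpoly = B.charpoly) : entropy A = entropy B := by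
  rw [entropy_eq_roots hA, entropy_eq_roots hB, h]

lemma entropy_submatrix {A : Matrix a a ℂ} (hA : A.IsHermitian) (e : b ≃ a) :
    entropy (A.submatrix e e) = entropy A :=
  entropy_congr_charpoly (hA.submatrix e) hA (charpoly_reindex e.symm A)

lemma entropy_transpose {A : Matrix a a ℂ} (hA : A.IsHermitian) : entropy Aᵀ = entropy A :=
  entropy_congr_charpoly hA.transpose hA (charpoly_transpose A)

lemma eta_zero : eta 0 = 0 := by simp [eta]

/-- The two characteristic polynomials agree up to powers of the variable, and the extra zero roots
contribute `eta 0 = 0`. -/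
lemma entropy_mul_conjTranspose (W : Matrix a b ℂ) : entropy (W * Wᴴ) = entropy (Wᴴ * W) := by
  have h1 := isHermitian_mul_conjTranspose_self W
  have h2 := isHermitian_conjTranspose_mul_self W
  have h := congrArg Polynomial.roots (charpoly_mul_comm' W Wᴴ)
  rw [Polynomial.roots_mul, Polynomial.roots_mul] at h
  · have h' := congrArg (fun s => (Multiset.map (fun z : ℂ => eta z.re) s).sum) h
    simpa [entropy_eq_roots h1, entropy_eq_roots h2, eta_zero, Multiset.map_nsmul,
      Multiset.sum_nsmul] using h'
  · exact mul_ne_zero (by simp) (charpoly_monic _).ne_zero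
  · exact mul_ne_zero (by simp) (charpoly_monic _).ne_zero

lemma entropy_diagonal (d : a → ℝ) :
    entropy (diagonal (fun i => (d i : ℂ))) = ∑ i, eta (d i) := by
  have h : (diagonal (fun i => (d i : ℂ))).IsHermitian := by
    refine isHermitian_diagonal_of_self_adjoint _ ?_
    ext i; simp
  rw [entropy_eq_roots h, charpoly_diagonal, Polynomial.roots_prod]
  · simp only [Polynomial.roots_X_sub_C, Multiset.bind_singleton, Multiset.map_map]
    rfl
  · simp [Finset.prod_ne_zero_iff, Polynomial.X_sub_C_ne_zero]

lemma charpoly_blockDiagonal (A : b → Matrix a a ℂ) :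
    (blockDiagonal A).charpoly = ∏ x, (A x).charpoly := by
  have h : charmatrix (blockDiagonal A) = blockDiagonal fun x => charmatrix (A x) := by
    ext ⟨i, k⟩ ⟨j, k'⟩
    simp only [charmatrix_apply, blockDiagonal_apply, diagonal_apply, Prod.mk.injEq]
    by_cases hk : k = k' <;> by_cases hi : i = j <;> simp [hk, hi]
  rw [charpoly, h, det_blockDiagonal]
  rfl

/-- The block diagonal operator `∑ x, |x⟩⟨x| ⊗ A x`. -/
def blockOp (A : b → Matrix a a ℂ) : Matrix (b × a) (b × a) ℂ :=
  of fun i j => if i.1 = j.1 then A i.1 i.2 j.2 else 0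

lemma blockOp_eq (A : b → Matrix a a ℂ) :
    blockOp A = (blockDiagonal A).submatrix (Equiv.prodComm b a) (Equiv.prodComm b a) := by
  ext ⟨x, i⟩ ⟨y, j⟩
  simp [blockOp, blockDiagonal_apply]

lemma isHermitian_blockOp {A : b → Matrix a a ℂ} (hA : ∀ x, (A x).IsHermitian) :
    (blockOp A).IsHermitian := by
  rw [blockOp_eq]
  refine IsHermitian.submatrix ?_ _
  rw [IsHermitian, blockDiagonal_conjTranspose]
  exact congrArg _ (funext hA)

lemma entropy_blockOp {A : b → Matrix a a ℂ} (hA : ∀ x, (A x).IsHermitian) :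
    entropy (blockOp A) = ∑ x, entropy (A x) := by
  have h : (blockDiagonal A).IsHermitian := by
    rw [IsHermitian, blockDiagonal_conjTranspose]
    exact congrArg _ (funext hA)
  rw [blockOp_eq, entropy_submatrix h, entropy_eq_roots h, charpoly_blockDiagonal,
    Polynomial.roots_prod _ _ (Finset.prod_ne_zero_iff.mpr fun x _ => (charpoly_monic _).ne_zero)]
  simp_rw [entropy_eq_roots (hA _)]
  rw [Multiset.map_bind, Multiset.sum_bind]
  rfl

lemma eta_mul (c x : ℝ) : eta (c * x) = c * eta x + x * eta c := by
  rcases eq_or_ne c 0 with rfl | hc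
  · simp [eta]
  rcases eq_or_ne x 0 with rfl | hx
  · simp [eta]
  rw [eta, eta, eta, Real.logb_mul hc hx]
  ring

lemma isHermitian_real_smul {A : Matrix a a ℂ} (hA : A.IsHermitian) (c : ℝ) :
    ((c : ℂ) • A).IsHermitian := by
  rw [IsHermitian, conjTranspose_smul, hA.eq]
  simp

lemma trace_re_eq_sum_eigenvalues {A : Matrix a a ℂ} (hA : A.IsHermitian) :
    A.trace.re = ∑ i, hA.eigenvalues i := by
  rw [hA.trace_eq_sum_eigenvalues]
  simp

lemma entropy_smul {A : Matrix a a ℂ} (hA : A.IsHermitian) (c : ℝ) :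
    entropy ((c : ℂ) • A) = c * entropy A + A.trace.re * eta c := by
  have h : ((c : ℂ) • A).charpoly
      = (diagonal (fun i => ((c * hA.eigenvalues i : ℝ) : ℂ))).charpoly := by
    conv_lhs => rw [eigen_decomp hA]
    rw [← Matrix.smul_mul, charpoly_mul_comm, Matrix.mul_smul, ← Matrix.mul_assoc,
      eigenvectorUnitary_conjTranspose_mul hA, Matrix.one_mul, ← diagonal_smul]
    congr 2
    ext i
    simp
  have h' : (diagonal (fun i => ((c * hA.eigenvalues i : ℝ) : ℂ))).IsHermitian := by
    refine isHermitian_diagonal_of_self_adjoint _ ?_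
    ext i; simp
  rw [entropy_congr_charpoly (isHermitian_real_smul hA c) h' h, entropy_diagonal,
    entropy_eq_sum hA, trace_re_eq_sum_eigenvalues hA, Finset.mul_sum, Finset.sum_mul,
    ← Finset.sum_add_distrib]
  exact Finset.sum_congr rfl fun i _ => eta_mul _ _

lemma eta_eq_negMulLog : eta = fun x => Real.negMulLog x / Real.log 2 := by
  ext x
  simp only [eta, Real.logb, Real.negMulLog]
  ring

lemma continuous_eta : Continuous eta := by
  rw [eta_eq_negMulLog]
  exact Real.continuous_negMulLog.div_const _

lemma spectrum_subset_of_isDensity {A : Matrix a a ℂ} (hA : IsDensity A) :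
    spectrum ℝ A ⊆ Set.Icc 0 1 := by
  rw [hA.1.isHermitian.spectrum_real_eq_range_eigenvalues]
  rintro _ ⟨i, rfl⟩
  refine ⟨hA.1.eigenvalues_nonneg i, ?_⟩
  have h := trace_re_eq_sum_eigenvalues hA.1.isHermitian
  have h1 : A.trace.re = 1 := by rw [hA.2, Complex.one_re]
  rw [← h1, h]
  exact Finset.single_le_sum (fun j _ => hA.1.eigenvalues_nonneg j) (Finset.mem_univ i)

open scoped Matrix.Norms.L2Operator in
lemma continuousOn_cfc_isDensity (f : ℝ → ℝ) (hf : Continuous f) :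
    ContinuousOn (fun A : Matrix a a ℂ => cfc f A) {A | IsDensity A} :=
  (continuousOn_cfc (Matrix a a ℂ) (p := IsSelfAdjoint) isCompact_Icc f hf.continuousOn).mono
    fun _ hA => ⟨hA.1.isHermitian, spectrum_subset_of_isDensity hA⟩

/-- Spectra of density operators stay in the fixed compact set `[0, 1]`, on which the functional
calculus of a continuous function is continuous in the matrix. -/
lemma continuousOn_entropy :
    ContinuousOn (fun A : Matrix a a ℂ => entropy A) {A | IsDensity A} := by
  refine ContinuousOn.congr (f := fun A => (cfc eta A).trace.re) ?_
    fun A hA => entropy_eq_trace_cfc hA.1.isHermitian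
  exact Complex.continuous_re.comp_continuousOn
    ((continuous_id.matrix_trace).comp_continuousOn (continuousOn_cfc_isDensity _ continuous_eta))

end Entropy
end PrivateDynamic

namespace PrivateDynamic

/-! ### Integral representation of the scalar relative entropy -/

section ScalarIntegral

/-- The integrand `(1 - u) (r - s)² / ((1 - u) s + u r)` representing `r log (r / s) - (r - s)`. -/
noncomputable def relKernel (r s u : ℝ) : ℝ := (1 - u) * ((r - s) ^ 2 / ((1 - u) * s + u * r))

/-- For positive `r` and `s` an antiderivative is `-(r - s) u + r log ((1 - u) s + u r)`. The
hypothesis `h` excludes the case of infinite relative entropy. -/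
lemma intervalIntegrable_relKernel_and_integral {r s : ℝ} (hr : 0 ≤ r) (hs : 0 ≤ s)
    (h : s = 0 → r = 0) :
    IntervalIntegrable (relKernel r s) MeasureTheory.volume 0 1 ∧
      ∫ u in (0 : ℝ)..1, relKernel r s u = r * Real.log r - r * Real.log s - (r - s) := by
  rcases hs.eq_or_lt with rfl | hs
  · obtain rfl := h rfl
    have : relKernel 0 0 = fun _ => 0 := by ext u; simp [relKernel]
    rw [this]
    simp
  rcases hr.eq_or_lt with rfl | hr
  -- With `r = 0` the kernel is the constant `s`, except at `u = 1`, where it takes the value `0`.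
  · have hae : ∀ᵐ u : ℝ, u ∈ Set.uIoc (0 : ℝ) 1 → s = relKernel 0 s u := by
      have : ∀ᵐ u : ℝ, u ≠ 1 := by
        simp [MeasureTheory.ae_iff]
      filter_upwards [this] with u hu _
      have : 1 - u ≠ 0 := sub_ne_zero.mpr hu.symm
      simp only [relKernel]
      field_simp
      ring
    refine ⟨?_, ?_⟩
    · refine (intervalIntegrable_const (c := s)).congr_ae ?_
      exact (MeasureTheory.ae_restrict_iff' measurableSet_uIoc).mpr hae
    · rw [← intervalIntegral.integral_congr_ae hae]
      simp
  have hpos : ∀ u ∈ Set.uIcc (0 : ℝ) 1, 0 < (1 - u) * s + u * r := by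
    intro u hu
    rw [Set.uIcc_of_le zero_le_one] at hu
    rcases hu.1.eq_or_lt with rfl | h0
    · simpa using hs
    · have := mul_pos h0 hr
      have := mul_nonneg (sub_nonneg.mpr hu.2) hs.le
      linarith
  have hc : ContinuousOn (relKernel r s) (Set.uIcc 0 1) := by
    unfold relKernel
    refine ContinuousOn.mul (by fun_prop) (ContinuousOn.div (by fun_prop) (by fun_prop) ?_)
    exact fun u hu => (hpos u hu).ne'
  refine ⟨hc.intervalIntegrable, ?_⟩
  have hd : ∀ u ∈ Set.uIcc (0 : ℝ) 1, HasDerivAt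
      (fun u => -(r - s) * u + r * Real.log ((1 - u) * s + u * r)) (relKernel r s u) u := by
    intro u hu
    have h1 : HasDerivAt (fun u : ℝ => (1 - u) * s + u * r) (r - s) u := by
      have := (((hasDerivAt_id u).const_sub 1).mul_const s).add ((hasDerivAt_id u).mul_const r)
      exact this.congr_deriv (by ring)
    have h2 := ((hasDerivAt_id u).const_mul (-(r - s))).add
      ((h1.log (hpos u hu).ne').const_mul r)
    refine h2.congr_deriv ?_
    have hD := (hpos u hu).ne'
    unfold relKernel
    have e : r - ((1 - u) * s + u * r) = (1 - u) * (r - s) := by ring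
    generalize (1 - u) * s + u * r = D at hD e
    calc -(r - s) * 1 + r * ((r - s) / D) = (r - s) * (r - D) / D := by field_simp; ring
      _ = (1 - u) * ((r - s) ^ 2 / D) := by rw [e]; ring
  rw [intervalIntegral.integral_eq_sub_of_hasDerivAt hd hc.intervalIntegrable]
  simp
  ring

lemma intervalIntegrable_sum {ι : Type*} [Fintype ι] {f : ι → ℝ → ℝ} {s t : ℝ}
    (h : ∀ i, IntervalIntegrable (f i) MeasureTheory.volume s t) :
    IntervalIntegrable (fun u => ∑ i, f i u) MeasureTheory.volume s t := by
  have := IntervalIntegrable.sum Finset.univ fun i _ => h i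
  rwa [Finset.sum_fn] at this

end ScalarIntegral

/-! ### Matrix relative entropy as an integral of quadratic divergences -/

section RelEnt

variable {a b : Type*} [Fintype a] [DecidableEq a] [Fintype b] [DecidableEq b]

/-- The overlaps of the eigenvectors of two Hermitian matrices. -/
noncomputable def overlap {A B : Matrix a a ℂ} (hA : A.IsHermitian) (hB : B.IsHermitian) :
    Matrix a a ℂ :=
  (hA.eigenvectorUnitary : Matrix a a ℂ)ᴴ * (hB.eigenvectorUnitary : Matrix a a ℂ)

/-- Weighting pairs of eigenvalues by squared overlaps reduces identities for two noncommuting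
matrices to scalar ones. -/
lemma trace_mul_cfc_eq_overlap {A B : Matrix a a ℂ} (hA : A.IsHermitian) (hB : B.IsHermitian)
    (f g : ℝ → ℝ) :
    (cfc f A * cfc g B).trace.re = ∑ i, ∑ j, Complex.normSq (overlap hA hB i j) *
      (f (hA.eigenvalues i) * g (hB.eigenvalues j)) := by
  rw [cfc_decomp hA, cfc_decomp hB]
  have : ((hA.eigenvectorUnitary : Matrix a a ℂ) * diagonal (fun i => (f (hA.eigenvalues i) : ℂ)) *
      (hA.eigenvectorUnitary : Matrix a a ℂ)ᴴ * ((hB.eigenvectorUnitary : Matrix a a ℂ) *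
      diagonal (fun i => (g (hB.eigenvalues i) : ℂ)) *
      (hB.eigenvectorUnitary : Matrix a a ℂ)ᴴ)).trace =
      (diagonal (fun i => (f (hA.eigenvalues i) : ℂ)) * overlap hA hB *
      diagonal (fun i => (g (hB.eigenvalues i) : ℂ)) * (overlap hA hB)ᴴ).trace := by
    rw [Matrix.mul_assoc, Matrix.mul_assoc, Matrix.trace_mul_comm]
    simp only [overlap, conjTranspose_mul, conjTranspose_conjTranspose, Matrix.mul_assoc]
  rw [this, Matrix.trace]
  simp only [Matrix.diag_apply, Matrix.mul_apply (N := (overlap hA hB)ᴴ), mul_diagonal,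
    diagonal_mul, conjTranspose_apply, Complex.re_sum]
  refine Finset.sum_congr rfl fun i _ => Finset.sum_congr rfl fun j _ => ?_
  rw [show (f (hA.eigenvalues i) : ℂ) * overlap hA hB i j * (g (hB.eigenvalues j) : ℂ) *
    star (overlap hA hB i j) = ((f (hA.eigenvalues i) * g (hB.eigenvalues j) : ℝ) : ℂ) *
    (overlap hA hB i j * (starRingEnd ℂ) (overlap hA hB i j)) by
      push_cast; rw [starRingEnd_apply]; ring,
    Complex.mul_conj, ← Complex.ofReal_mul, Complex.ofReal_re]
  ring

/-- The relative entropy (in nats) `Tr A log A - Tr A log B`. -/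
noncomputable def relEnt (A B : Matrix a a ℂ) : ℝ :=
  (A * cfc Real.log A).trace.re - (A * cfc Real.log B).trace.re

/-- The quadratic divergence `∑ |⟨i|j⟩|² (rᵢ - sⱼ)² / ((1 - u) sⱼ + u rᵢ)`, with weight `1 - u`. -/
noncomputable def quadDiv {A B : Matrix a a ℂ} (hA : A.IsHermitian) (hB : B.IsHermitian)
    (u : ℝ) : ℝ :=
  ∑ i, ∑ j, Complex.normSq (overlap hA hB i j) *
    relKernel (hA.eigenvalues i) (hB.eigenvalues j) u

lemma cfc_id_hermitian {A : Matrix a a ℂ} (hA : A.IsHermitian) : cfc (fun x : ℝ => x) A = A :=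
  cfc_id' ℝ A hA

lemma cfc_one_hermitian {A : Matrix a a ℂ} (hA : A.IsHermitian) :
    cfc (fun _ : ℝ => (1 : ℝ)) A = 1 :=
  cfc_const_one ℝ A hA

lemma mul_cfc_log {A : Matrix a a ℂ} (hA : A.IsHermitian) :
    A * cfc Real.log A = cfc (fun x => x * Real.log x) A := by
  have h := eigenvectorUnitary_conjTranspose_mul hA
  conv_lhs => enter [1]; rw [eigen_decomp hA]
  rw [cfc_decomp hA, cfc_decomp hA]
  simp only [Matrix.mul_assoc]
  rw [← Matrix.mul_assoc _ _ (diagonal _ * _), h, Matrix.one_mul,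
    ← Matrix.mul_assoc (diagonal _) (diagonal _), diagonal_mul_diagonal]
  simp

/-- If the eigenvector `j` lies in the kernel of `B`, then `A ≤ B` gives `⟨j|A|j⟩ ≤ 0`. This is a
sum of nonnegative terms `rₖ |⟨k|j⟩|²`, so each vanishes. Pairs with nonzero overlap thus satisfy
the side condition of the scalar integral. -/
lemma overlap_eq_zero {A B : Matrix a a ℂ} (hA : A.PosSemidef) (hB : B.PosSemidef)
    (hAB : (B - A).PosSemidef) (i j : a) (hj : hB.isHermitian.eigenvalues j = 0) :
    hA.isHermitian.eigenvalues i = 0 ∨ overlap hA.isHermitian hB.isHermitian i j = 0 := by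
  set v := (hB.isHermitian.eigenvectorUnitary : Matrix a a ℂ)
  have h1 := (hAB.conjTranspose_mul_mul_same v).diag_nonneg (i := j)
  have hBv : vᴴ * B * v = diagonal (fun i => (hB.isHermitian.eigenvalues i : ℂ)) := by
    conv_lhs => enter [1, 2]; rw [eigen_decomp hB.isHermitian]
    simp only [Matrix.mul_assoc]
    rw [eigenvectorUnitary_conjTranspose_mul, ← Matrix.mul_assoc,
      eigenvectorUnitary_conjTranspose_mul, Matrix.one_mul, Matrix.mul_one]
  have hAv : vᴴ * A * v = (overlap hA.isHermitian hB.isHermitian)ᴴ *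
      diagonal (fun i => (hA.isHermitian.eigenvalues i : ℂ)) *
      overlap hA.isHermitian hB.isHermitian := by
    conv_lhs => enter [1, 2]; rw [eigen_decomp hA.isHermitian]
    simp only [overlap, conjTranspose_mul, conjTranspose_conjTranspose, Matrix.mul_assoc]
    rfl
  rw [Matrix.mul_sub, Matrix.sub_mul, hBv, hAv, Matrix.sub_apply, diagonal_apply_eq, hj] at h1
  have h2 := (Complex.le_def.mp h1).1
  simp only [Matrix.mul_apply (N := overlap hA.isHermitian hB.isHermitian), mul_diagonal,
    conjTranspose_apply,
    Complex.neg_re, Complex.re_sum, Complex.ofReal_zero, Complex.zero_re, zero_sub] at h2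
  have h3 : ∀ k, (star (overlap hA.isHermitian hB.isHermitian k j) *
      (hA.isHermitian.eigenvalues k : ℂ) * overlap hA.isHermitian hB.isHermitian k j).re =
      hA.isHermitian.eigenvalues k *
        Complex.normSq (overlap hA.isHermitian hB.isHermitian k j) := by
    intro k
    rw [mul_right_comm, mul_comm, ← starRingEnd_apply, mul_comm ((starRingEnd ℂ) _),
      Complex.mul_conj, ← Complex.ofReal_mul, Complex.ofReal_re]
  simp only [h3] at h2
  have h4 := (Finset.sum_eq_zero_iff_of_nonneg (fun k _ =>
    mul_nonneg (hA.eigenvalues_nonneg k) (Complex.normSq_nonneg _))).mp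
    (le_antisymm (by linarith) (Finset.sum_nonneg fun k _ =>
      mul_nonneg (hA.eigenvalues_nonneg k) (Complex.normSq_nonneg _))) i (Finset.mem_univ i)
  simpa using h4

lemma intervalIntegrable_quadDiv_and_relEnt_eq {A B : Matrix a a ℂ} (hA : A.PosSemidef)
    (hB : B.PosSemidef) (hAB : (B - A).PosSemidef) :
    IntervalIntegrable (quadDiv hA.isHermitian hB.isHermitian) MeasureTheory.volume 0 1 ∧
    relEnt A B = A.trace.re - B.trace.re +
      ∫ u in (0 : ℝ)..1, quadDiv hA.isHermitian hB.isHermitian u := by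
  set c := overlap hA.isHermitian hB.isHermitian with hc
  set r := hA.isHermitian.eigenvalues with hr
  set s := hB.isHermitian.eigenvalues with hs
  have key : ∀ i j, IntervalIntegrable
      (fun u => Complex.normSq (c i j) * relKernel (r i) (s j) u) MeasureTheory.volume 0 1 ∧
      ∫ u in (0 : ℝ)..1, Complex.normSq (c i j) * relKernel (r i) (s j) u =
      Complex.normSq (c i j) *
        (r i * Real.log (r i) - r i * Real.log (s j) - (r i - s j)) := by
    intro i j
    by_cases hz : c i j = 0
    · simp [hz]
    have h := intervalIntegrable_relKernel_and_integral (hA.eigenvalues_nonneg i)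
      (hB.eigenvalues_nonneg j) fun hj => (overlap_eq_zero hA hB hAB i j hj).resolve_right hz
    refine ⟨h.1.const_mul _, ?_⟩
    rw [intervalIntegral.integral_const_mul, h.2]
  have hint : ∀ i, IntervalIntegrable
      (fun u => ∑ j, Complex.normSq (c i j) * relKernel (r i) (s j) u)
      MeasureTheory.volume 0 1 := fun i =>
    intervalIntegrable_sum fun j => (key i j).1
  refine ⟨intervalIntegrable_sum fun i => hint i, ?_⟩
  unfold quadDiv
  rw [intervalIntegral.integral_finsetSum fun i _ => hint i]
  have e1 : ∀ i, ∫ u in (0 : ℝ)..1, ∑ j, Complex.normSq (c i j) * relKernel (r i) (s j) u =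
      ∑ j, Complex.normSq (c i j) *
        (r i * Real.log (r i) - r i * Real.log (s j) - (r i - s j)) := by
    intro i
    rw [intervalIntegral.integral_finsetSum fun j _ => (key i j).1]
    exact Finset.sum_congr rfl fun j _ => (key i j).2
  rw [Finset.sum_congr rfl fun i _ => e1 i]
  -- Inserting the constant function `1` writes all four traces as sums over the same pairs of
  -- eigenvalues.
  have t1 := trace_mul_cfc_eq_overlap hA.isHermitian hB.isHermitian
    (fun x => x * Real.log x) (fun _ => 1)
  have t2 := trace_mul_cfc_eq_overlap hA.isHermitian hB.isHermitian (fun x => x) Real.log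
  have t3 := trace_mul_cfc_eq_overlap hA.isHermitian hB.isHermitian (fun x => x) (fun _ => 1)
  have t4 := trace_mul_cfc_eq_overlap hA.isHermitian hB.isHermitian (fun _ => 1) (fun x => x)
  rw [← mul_cfc_log hA.isHermitian, cfc_one_hermitian hB.isHermitian, Matrix.mul_one] at t1
  rw [cfc_id_hermitian hA.isHermitian] at t2
  rw [cfc_id_hermitian hA.isHermitian, cfc_one_hermitian hB.isHermitian, Matrix.mul_one] at t3
  rw [cfc_id_hermitian hB.isHermitian, cfc_one_hermitian hA.isHermitian, Matrix.one_mul] at t4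
  rw [relEnt, t1, t2, t3, t4]
  simp only [← Finset.sum_sub_distrib, ← Finset.sum_add_distrib]
  refine Finset.sum_congr rfl fun i _ => Finset.sum_congr rfl fun j _ => ?_
  simp only [← hc, ← hr, ← hs]
  ring

end RelEnt
end PrivateDynamic

namespace PrivateDynamic

/-! ### Variational formula, monotonicity of relative entropy and data processing -/

section Variational

variable {a b κ : Type*} [Fintype a] [DecidableEq a] [Fintype b] [DecidableEq b] [Fintype κ]

/-- The concave form in `X` whose supremum is the quadratic divergence of `A` and `B`. -/
noncomputable def varForm (u : ℝ) (A B X : Matrix a a ℂ) : ℝ :=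
  2 * (Xᴴ * (A - B)).trace.re - u * (X * Xᴴ * A).trace.re - (1 - u) * (Xᴴ * X * B).trace.re

/-- In the two eigenbases the form decouples into one quadratic function for each entry `x i j`,
which can be maximised separately. -/
lemma varForm_eq {A B : Matrix a a ℂ} (hA : A.IsHermitian) (hB : B.IsHermitian) (u : ℝ)
    (x : Matrix a a ℂ) :
    varForm u A B ((hA.eigenvectorUnitary : Matrix a a ℂ) * x *
        (hB.eigenvectorUnitary : Matrix a a ℂ)ᴴ) =
      ∑ i, ∑ j, (2 * ((hA.eigenvalues i - hB.eigenvalues j) *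
          (star (x i j) * overlap hA hB i j).re) -
        ((1 - u) * hB.eigenvalues j + u * hA.eigenvalues i) * Complex.normSq (x i j)) := by
  have hP := eigenvectorUnitary_conjTranspose_mul hA
  have hQ := eigenvectorUnitary_conjTranspose_mul hB
  have hAd := eigen_decomp hA
  have hBd := eigen_decomp hB
  have hc : overlap hA hB = (hA.eigenvectorUnitary : Matrix a a ℂ)ᴴ *
    (hB.eigenvectorUnitary : Matrix a a ℂ) := rfl
  generalize overlap hA hB = c at hc ⊢
  generalize (hA.eigenvectorUnitary : Matrix a a ℂ) = P at hP hAd hc ⊢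
  generalize (hB.eigenvectorUnitary : Matrix a a ℂ) = Q at hQ hBd hc ⊢
  generalize hA.eigenvalues = r at hAd ⊢
  generalize hB.eigenvalues = s at hBd ⊢
  have t1 : ((P * x * Qᴴ)ᴴ * A).trace = (xᴴ * (diagonal (fun i => (r i : ℂ)) * c)).trace := by
    rw [hAd, conjTranspose_mul, conjTranspose_mul, conjTranspose_conjTranspose, Matrix.mul_assoc Q,
      Matrix.trace_mul_comm]
    simp only [Matrix.mul_assoc]
    rw [← Matrix.mul_assoc Pᴴ P, hP, Matrix.one_mul, hc]
  have t2 : ((P * x * Qᴴ)ᴴ * B).trace = (xᴴ * (c * diagonal (fun i => (s i : ℂ)))).trace := by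
    rw [hBd, conjTranspose_mul, conjTranspose_mul, conjTranspose_conjTranspose, Matrix.mul_assoc Q,
      Matrix.trace_mul_comm]
    simp only [Matrix.mul_assoc]
    rw [hQ, Matrix.mul_one, hc]
    simp only [Matrix.mul_assoc]
  have t3 : ((P * x * Qᴴ) * (P * x * Qᴴ)ᴴ * A).trace =
      (xᴴ * (diagonal (fun i => (r i : ℂ)) * x)).trace := by
    rw [hAd, conjTranspose_mul, conjTranspose_mul, conjTranspose_conjTranspose]
    simp only [Matrix.mul_assoc]
    rw [← Matrix.mul_assoc Qᴴ Q, hQ, Matrix.one_mul, ← Matrix.mul_assoc Pᴴ P, hP, Matrix.one_mul,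
      Matrix.trace_mul_comm]
    simp only [Matrix.mul_assoc]
    rw [hP, Matrix.mul_one, Matrix.trace_mul_comm]
    simp only [Matrix.mul_assoc]
  have t4 : ((P * x * Qᴴ)ᴴ * (P * x * Qᴴ) * B).trace =
      (xᴴ * (x * diagonal (fun i => (s i : ℂ)))).trace := by
    rw [hBd, conjTranspose_mul, conjTranspose_mul, conjTranspose_conjTranspose]
    simp only [Matrix.mul_assoc]
    rw [← Matrix.mul_assoc Qᴴ Q, hQ, Matrix.one_mul, ← Matrix.mul_assoc Pᴴ P, hP, Matrix.one_mul,
      Matrix.trace_mul_comm]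
    simp only [Matrix.mul_assoc]
    rw [hQ, Matrix.mul_one]
  rw [varForm, Matrix.mul_sub, Matrix.trace_sub, t1, t2, t3, t4]
  simp only [Matrix.trace, Matrix.diag_apply, Matrix.mul_apply (M := xᴴ), mul_diagonal,
    diagonal_mul, conjTranspose_apply, Complex.re_sum, Complex.sub_re]
  rw [Finset.sum_comm, Finset.sum_comm (f := fun i j => (star (x j i) * (c j i * _)).re),
    Finset.sum_comm (f := fun i j => (star (x j i) * ((r j : ℂ) * x j i)).re),
    Finset.sum_comm (f := fun i j => (star (x j i) * (x j i * _)).re)]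
  simp only [Finset.mul_sum, ← Finset.sum_sub_distrib]
  refine Finset.sum_congr rfl fun i _ => Finset.sum_congr rfl fun j _ => ?_
  simp only [Complex.normSq_apply, Complex.mul_re, Complex.mul_im, Complex.star_def,
    Complex.conj_re, Complex.conj_im, Complex.ofReal_re, Complex.ofReal_im]
  ring

/-- Completing the square: expand `|d c - w x|² ≥ 0` and divide by `w`. Equality holds at `x = (d /
w) c`, the choice of the next lemma. -/
lemma two_mul_re_sub_le {x c : ℂ} {d w : ℝ} (hw : 0 ≤ w) (hd : w = 0 → d = 0) :
    2 * (d * (star x * c).re) - w * Complex.normSq x ≤ Complex.normSq c * (d ^ 2 / w) := by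
  rcases hw.eq_or_lt with rfl | hw
  · simp [hd rfl]
  have h := Complex.normSq_nonneg ((d : ℂ) * c - w * x)
  rw [← mul_div_assoc, le_div_iff₀ hw]
  simp only [Complex.normSq_apply, Complex.mul_re, Complex.mul_im, Complex.star_def,
    Complex.conj_re, Complex.conj_im, Complex.sub_re, Complex.sub_im, Complex.ofReal_re,
    Complex.ofReal_im] at h ⊢
  linarith

lemma two_mul_re_sub_eq (c : ℂ) (d w : ℝ) :
    2 * (d * (star (((d / w : ℝ) : ℂ) * c) * c).re) -
      w * Complex.normSq (((d / w : ℝ) : ℂ) * c) = Complex.normSq c * (d ^ 2 / w) := by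
  rcases eq_or_ne w 0 with rfl | hw
  · simp
  simp only [Complex.normSq_apply, Complex.mul_re, Complex.mul_im, Complex.star_def,
    Complex.conj_re, Complex.conj_im, Complex.ofReal_re, Complex.ofReal_im]
  field_simp
  ring

lemma weight_nonneg {r s u : ℝ} (hr : 0 ≤ r) (hs : 0 ≤ s) (hu0 : 0 < u) (hu1 : u < 1) :
    0 ≤ (1 - u) * s + u * r ∧ ((1 - u) * s + u * r = 0 → r - s = 0) := by
  have h1 : 0 < 1 - u := by linarith
  refine ⟨by positivity, fun h => ?_⟩
  have h2 : (1 - u) * s = 0 := by nlinarith [mul_nonneg h1.le hs, mul_nonneg hu0.le hr]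
  have h3 : u * r = 0 := by linarith
  rw [(mul_eq_zero.mp h2).resolve_left h1.ne', (mul_eq_zero.mp h3).resolve_left hu0.ne', sub_zero]

lemma mul_varForm_le_quadDiv {A B : Matrix a a ℂ} (hA : A.PosSemidef) (hB : B.PosSemidef)
    {u : ℝ} (hu0 : 0 < u) (hu1 : u < 1) (X : Matrix a a ℂ) :
    (1 - u) * varForm u A B X ≤ quadDiv hA.isHermitian hB.isHermitian u := by
  have hX : X = (hA.isHermitian.eigenvectorUnitary : Matrix a a ℂ) *
      ((hA.isHermitian.eigenvectorUnitary : Matrix a a ℂ)ᴴ * X *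
        (hB.isHermitian.eigenvectorUnitary : Matrix a a ℂ)) *
      (hB.isHermitian.eigenvectorUnitary : Matrix a a ℂ)ᴴ := by
    simp only [Matrix.mul_assoc]
    rw [eigenvectorUnitary_mul_conjTranspose, Matrix.mul_one, ← Matrix.mul_assoc,
      eigenvectorUnitary_mul_conjTranspose, Matrix.one_mul]
  rw [hX, varForm_eq, quadDiv, Finset.mul_sum]
  refine Finset.sum_le_sum fun i _ => ?_
  rw [Finset.mul_sum]
  refine Finset.sum_le_sum fun j _ => ?_
  have hw := weight_nonneg (hA.eigenvalues_nonneg i) (hB.eigenvalues_nonneg j) hu0 hu1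
  rw [relKernel, mul_left_comm (Complex.normSq _)]
  exact mul_le_mul_of_nonneg_left (two_mul_re_sub_le hw.1 hw.2) (sub_nonneg.mpr hu1.le)

/-- The entrywise maximisers attain the bound. No restriction on `u` is needed, since for zero
weight the convention `d / 0 = 0` makes both sides zero. -/
lemma exists_mul_varForm_eq_quadDiv {A B : Matrix a a ℂ} (hA : A.PosSemidef) (hB : B.PosSemidef)
    (u : ℝ) :
    ∃ X, (1 - u) * varForm u A B X = quadDiv hA.isHermitian hB.isHermitian u := by
  have h := varForm_eq hA.isHermitian hB.isHermitian u (of fun i j =>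
    (((hA.isHermitian.eigenvalues i - hB.isHermitian.eigenvalues j) /
      ((1 - u) * hB.isHermitian.eigenvalues j + u * hA.isHermitian.eigenvalues i) : ℝ) : ℂ) *
      overlap hA.isHermitian hB.isHermitian i j)
  refine ⟨_, (congrArg _ h).trans ?_⟩
  rw [quadDiv, Finset.mul_sum]
  refine Finset.sum_congr rfl fun i _ => ?_
  rw [Finset.mul_sum]
  refine Finset.sum_congr rfl fun j _ => ?_
  rw [relKernel, mul_left_comm (Complex.normSq _), of_apply, two_mul_re_sub_eq]

/-- The action `A ↦ ∑ k, K k A (K k)ᴴ` of Kraus operators. -/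
def krausMap (K : κ → Matrix b a ℂ) (A : Matrix a a ℂ) : Matrix b b ℂ := ∑ k, K k * A * (K k)ᴴ

/-- The dual action `Y ↦ ∑ k, (K k)ᴴ Y K k` of Kraus operators. -/
def krausDual (K : κ → Matrix b a ℂ) (Y : Matrix b b ℂ) : Matrix a a ℂ := ∑ k, (K k)ᴴ * Y * K k

lemma krausMap_sub (K : κ → Matrix b a ℂ) (A B : Matrix a a ℂ) :
    krausMap K (A - B) = krausMap K A - krausMap K B := by
  simp [krausMap, Matrix.mul_sub, Matrix.sub_mul]

lemma krausMap_sum {ι : Type*} (s : Finset ι) (K : κ → Matrix b a ℂ) (A : ι → Matrix a a ℂ) :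
    krausMap K (∑ z ∈ s, A z) = ∑ z ∈ s, krausMap K (A z) := by
  simp only [krausMap, Matrix.mul_sum, Matrix.sum_mul]
  exact Finset.sum_comm

lemma krausMap_posSemidef (K : κ → Matrix b a ℂ) {A : Matrix a a ℂ} (hA : A.PosSemidef) :
    (krausMap K A).PosSemidef :=
  posSemidef_sum _ fun k _ => hA.mul_mul_conjTranspose_same (K k)

lemma trace_mul_krausMap (K : κ → Matrix b a ℂ) (A : Matrix a a ℂ) (Y : Matrix b b ℂ) :
    (Y * krausMap K A).trace = (krausDual K Y * A).trace := by
  simp only [krausMap, krausDual, Matrix.mul_sum, Matrix.sum_mul, trace_sum]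
  refine Finset.sum_congr rfl fun k _ => ?_
  rw [← Matrix.mul_assoc, Matrix.trace_mul_comm]
  simp only [Matrix.mul_assoc]

lemma trace_krausMap {K : κ → Matrix b a ℂ} (hK : ∑ k, (K k)ᴴ * K k = 1) (A : Matrix a a ℂ) :
    (krausMap K A).trace = A.trace := by
  have := trace_mul_krausMap K A 1
  simpa [krausDual, hK] using this

lemma krausDual_conjTranspose (K : κ → Matrix b a ℂ) (Y : Matrix b b ℂ) :
    (krausDual K Y)ᴴ = krausDual K Yᴴ := by
  simp [krausDual, conjTranspose_sum, Matrix.mul_assoc]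

/-- The Kadison–Schwarz inequality, tested against a positive semidefinite matrix. -/
lemma trace_krausDual_mul_le {K : κ → Matrix b a ℂ} (hK : ∑ k, (K k)ᴴ * K k = 1)
    {A : Matrix a a ℂ} (hA : A.PosSemidef) (Y : Matrix b b ℂ) :
    (krausDual K Y * (krausDual K Y)ᴴ * A).trace.re ≤ (Y * Yᴴ * krausMap K A).trace.re := by
  rw [trace_mul_krausMap]
  set Z := krausDual K Y with hZ
  -- The Schwarz defect is a sum of squares; trace preservation `∑ (K k)ᴴ * K k = 1` turns the last
  -- term of the expansion into `Z * Zᴴ`.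
  have h : krausDual K (Y * Yᴴ) - Z * Zᴴ =
      ∑ k, ((K k)ᴴ * Y - Z * (K k)ᴴ) * ((K k)ᴴ * Y - Z * (K k)ᴴ)ᴴ := by
    have e : ∀ k, ((K k)ᴴ * Y - Z * (K k)ᴴ) * ((K k)ᴴ * Y - Z * (K k)ᴴ)ᴴ =
        (K k)ᴴ * (Y * Yᴴ) * K k - ((K k)ᴴ * Y * K k) * Zᴴ - Z * ((K k)ᴴ * Yᴴ * K k) +
          Z * ((K k)ᴴ * K k) * Zᴴ := by
      intro k
      simp only [conjTranspose_sub, conjTranspose_mul, conjTranspose_conjTranspose,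
        Matrix.sub_mul, Matrix.mul_sub, Matrix.mul_assoc]
      abel
    simp only [e, Finset.sum_add_distrib, Finset.sum_sub_distrib, ← Matrix.sum_mul,
      ← Matrix.mul_sum, hK, Matrix.mul_one]
    change _ = krausDual K (Y * Yᴴ) - Z * Zᴴ - Z * krausDual K Yᴴ + Z * Zᴴ
    rw [← krausDual_conjTranspose]
    abel
  have h2 : 0 ≤ ((krausDual K (Y * Yᴴ) - Z * Zᴴ) * A).trace.re := by
    rw [h, Matrix.sum_mul, trace_sum, Complex.re_sum]
    refine Finset.sum_nonneg fun k _ => ?_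
    generalize (K k)ᴴ * Y - Z * (K k)ᴴ = T
    rw [Matrix.mul_assoc, Matrix.trace_mul_comm]
    have hT := hA.conjTranspose_mul_mul_same T
    exact (Complex.le_def.mp hT.trace_nonneg).1
  rw [Matrix.sub_mul, trace_sub, Complex.sub_re] at h2
  linarith

/-- The linear term passes through the dual map unchanged; the two quadratic terms are controlled by
Kadison–Schwarz for `Y` and for `Yᴴ`. -/
lemma varForm_krausMap_le {K : κ → Matrix b a ℂ} (hK : ∑ k, (K k)ᴴ * K k = 1)
    {A B : Matrix a a ℂ} (hA : A.PosSemidef) (hB : B.PosSemidef) {u : ℝ} (hu0 : 0 ≤ u)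
    (hu1 : u ≤ 1) (Y : Matrix b b ℂ) :
    varForm u (krausMap K A) (krausMap K B) Y ≤ varForm u A B (krausDual K Y) := by
  have h1 := mul_le_mul_of_nonneg_left (trace_krausDual_mul_le hK hA Y) hu0
  have h2 := mul_le_mul_of_nonneg_left (trace_krausDual_mul_le hK hB Yᴴ) (sub_nonneg.mpr hu1)
  rw [← krausDual_conjTranspose, conjTranspose_conjTranspose, conjTranspose_conjTranspose] at h2
  rw [varForm, varForm, ← krausMap_sub, trace_mul_krausMap, ← krausDual_conjTranspose]
  linarith

/-- Monotonicity of the relative entropy under quantum channels. -/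
lemma relEnt_krausMap_le {K : κ → Matrix b a ℂ} (hK : ∑ k, (K k)ᴴ * K k = 1)
    {A B : Matrix a a ℂ} (hA : A.PosSemidef) (hB : B.PosSemidef) (hAB : (B - A).PosSemidef) :
    relEnt (krausMap K A) (krausMap K B) ≤ relEnt A B := by
  have hA' := krausMap_posSemidef K hA
  have hB' := krausMap_posSemidef K hB
  have hAB' := krausMap_posSemidef K hAB
  rw [krausMap_sub] at hAB'
  obtain ⟨i1, e1⟩ := intervalIntegrable_quadDiv_and_relEnt_eq hA hB hAB
  obtain ⟨i2, e2⟩ := intervalIntegrable_quadDiv_and_relEnt_eq hA' hB' hAB'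
  rw [e1, e2, trace_krausMap hK, trace_krausMap hK]
  refine add_le_add_right ?_ _
  refine intervalIntegral.integral_mono_on_of_le_Ioo zero_le_one i2 i1 fun u hu => ?_
  -- The optimal `Y` for the outputs, pulled back by the dual map, is an admissible test matrix for
  -- the inputs.
  obtain ⟨Y, hY⟩ := exists_mul_varForm_eq_quadDiv hA' hB' u
  rw [← hY]
  exact (mul_le_mul_of_nonneg_left (varForm_krausMap_le hK hA hB hu.1.le hu.2.le Y)
    (sub_nonneg.mpr hu.2.le)).trans (mul_varForm_le_quadDiv hA hB hu.1 hu.2 _)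

lemma entropy_eq_log {A : Matrix a a ℂ} (hA : A.IsHermitian) :
    entropy A = -(A * cfc Real.log A).trace.re / Real.log 2 := by
  rw [entropy, mul_cfc_logb hA, mul_cfc_log hA, trace_neg, Complex.neg_re,
    ← entropy_eq_trace_cfc hA, entropy_eq_sum hA, cfc_decomp hA, Matrix.trace_mul_comm,
    ← Matrix.mul_assoc, eigenvectorUnitary_conjTranspose_mul hA, Matrix.one_mul, trace_diagonal]
  simp only [Complex.re_sum, Complex.ofReal_re, neg_neg, eta, Real.logb, ← Finset.sum_neg_distrib,
    Finset.sum_div]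
  exact Finset.sum_congr rfl fun i _ => by ring

/-- The cross terms add up to the trace of `S log S` with `S` the sum, so the Holevo quantity is a
sum of relative entropies; no normalisation is required. -/
lemma sum_relEnt {ι : Type*} [Fintype ι] {A : ι → Matrix a a ℂ} (hA : ∀ z, (A z).PosSemidef) :
    ∑ z, relEnt (A z) (∑ z', A z') =
      Real.log 2 * (entropy (∑ z, A z) - ∑ z, entropy (A z)) := by
  have h2 : Real.log 2 ≠ 0 := (Real.log_pos one_lt_two).ne'
  simp only [entropy_eq_log (posSemidef_sum _ fun z _ => hA z).isHermitian,
    fun z => entropy_eq_log (hA z).isHermitian, relEnt, Finset.sum_sub_distrib]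
  rw [← Complex.re_sum, ← Complex.re_sum, ← trace_sum, ← trace_sum, ← Matrix.sum_mul,
    ← Finset.sum_div, Finset.sum_neg_distrib, ← Complex.re_sum, ← trace_sum]
  field_simp
  ring

/-- Data processing for the Holevo quantity of an unnormalised ensemble. -/
theorem holevo_krausMap_le {ι : Type*} [Fintype ι] {K : κ → Matrix b a ℂ}
    (hK : ∑ k, (K k)ᴴ * K k = 1) {A : ι → Matrix a a ℂ} (hA : ∀ z, (A z).PosSemidef) :
    entropy (∑ z, krausMap K (A z)) - ∑ z, entropy (krausMap K (A z)) ≤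
      entropy (∑ z, A z) - ∑ z, entropy (A z) := by
  classical
  have h : ∑ z, relEnt (krausMap K (A z)) (∑ z', krausMap K (A z')) ≤
      ∑ z, relEnt (A z) (∑ z', A z') := by
    refine Finset.sum_le_sum fun z _ => ?_
    rw [← krausMap_sum]
    refine relEnt_krausMap_le hK (hA z) (posSemidef_sum _ fun z _ => hA z) ?_
    -- The difference is the sum of the remaining members, hence positive semidefinite.
    rw [← Finset.add_sum_erase _ _ (Finset.mem_univ z), add_sub_cancel_left]
    exact posSemidef_sum _ fun z _ => hA z
  rw [sum_relEnt hA, sum_relEnt fun z => krausMap_posSemidef K (hA z)] at h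
  exact le_of_mul_le_mul_left h (Real.log_pos one_lt_two)

/-- Concavity of the entropy, for an unnormalised ensemble. -/
theorem sum_entropy_sub_le {ι : Type*} [Fintype ι] {A : ι → Matrix a a ℂ}
    (hA : ∀ z, (A z).PosSemidef) :
    ∑ z, (entropy (A z) - eta (A z).trace.re) ≤
      entropy (∑ z, A z) - eta (∑ z, A z).trace.re := by
  -- The bras `⟨k|` are Kraus operators of the trace, viewed as a channel onto a one-dimensional
  -- system, whose output entropy is `eta` of the trace.
  have hK : ∑ k : a, (replicateRow Unit (Pi.single k (1 : ℂ)))ᴴ *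
      replicateRow Unit (Pi.single k (1 : ℂ)) = 1 := by
    ext i j
    simp [Matrix.sum_apply, Matrix.mul_apply, Pi.single_apply, Matrix.one_apply]
  have hM : ∀ M : Matrix a a ℂ, M.IsHermitian →
      krausMap (fun k : a => replicateRow Unit (Pi.single k (1 : ℂ))) M =
        diagonal fun _ => (M.trace.re : ℂ) := by
    intro M hM
    have hre : (M.trace.re : ℂ) = M.trace := by
      rw [hM.trace_eq_sum_eigenvalues]; simp
    rw [hre]
    ext i j
    simp [krausMap, Matrix.sum_apply, Matrix.mul_apply, Pi.single_apply, Matrix.trace]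
  have h := holevo_krausMap_le hK hA
  rw [← krausMap_sum, hM _ (posSemidef_sum _ fun z _ => hA z).isHermitian, entropy_diagonal] at h
  simp only [fun z => hM _ (hA z).isHermitian, entropy_diagonal] at h
  simp only [Finset.univ_unique, Finset.sum_singleton] at h
  rw [Finset.sum_sub_distrib]
  linarith

end Variational
end PrivateDynamic

namespace PrivateDynamic

/-! ### Complementary channels and coherent information -/

section Channels

variable {a b e κ : Type*} [Fintype a] [DecidableEq a] [Fintype b] [DecidableEq b]
  [Fintype e] [DecidableEq e] [Fintype κ]

lemma krausMap_smul (K : κ → Matrix b a ℂ) (c : ℂ) (A : Matrix a a ℂ) :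
    krausMap K (c • A) = c • krausMap K A := by
  simp [krausMap, Finset.smul_sum]

/-- The Kraus operators of the complementary channel. -/
def envKraus (U : Matrix (b × e) a ℂ) (k : b) : Matrix e a ℂ := of fun j i => U (k, j) i

lemma complementary_eq_krausMap (U : Matrix (b × e) a ℂ) (ρ : Matrix a a ℂ) :
    complementary U ρ = krausMap (envKraus U) ρ := by
  ext i j
  simp only [complementary, traceFst, krausMap, of_apply, Matrix.sum_apply]
  rfl

lemma sum_envKraus {U : Matrix (b × e) a ℂ} (hU : Uᴴ * U = 1) :
    ∑ k, (envKraus U k)ᴴ * envKraus U k = 1 := by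
  rw [← hU]
  ext i j
  simp [Matrix.sum_apply, Matrix.mul_apply, envKraus, Fintype.sum_prod_type]

lemma complementary_posSemidef (U : Matrix (b × e) a ℂ) {ρ : Matrix a a ℂ} (h : ρ.PosSemidef) :
    (complementary U ρ).PosSemidef := by
  rw [complementary_eq_krausMap]; exact krausMap_posSemidef _ h

lemma complementary_smul (U : Matrix (b × e) a ℂ) (c : ℂ) (ρ : Matrix a a ℂ) :
    complementary U (c • ρ) = c • complementary U ρ := by
  simp only [complementary_eq_krausMap, krausMap_smul]

lemma complementary_sum {ι : Type*} (s : Finset ι) (U : Matrix (b × e) a ℂ)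
    (ρ : ι → Matrix a a ℂ) : complementary U (∑ z ∈ s, ρ z) = ∑ z ∈ s, complementary U (ρ z) := by
  simp only [complementary_eq_krausMap, krausMap_sum]

lemma trace_complementary {U : Matrix (b × e) a ℂ} (hU : Uᴴ * U = 1) (ρ : Matrix a a ℂ) :
    (complementary U ρ).trace = ρ.trace := by
  rw [complementary_eq_krausMap, trace_krausMap (sum_envKraus hU)]

lemma IsChannel.exists_krausMap {N : Matrix a a ℂ →ₗ[ℂ] Matrix b b ℂ} (hN : IsChannel N) :
    ∃ (n : ℕ) (K : Fin n → Matrix b a ℂ), ∑ k, (K k)ᴴ * K k = 1 ∧ ∀ ρ, N ρ = krausMap K ρ := hN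

lemma IsChannel.posSemidef {N : Matrix a a ℂ →ₗ[ℂ] Matrix b b ℂ} (hN : IsChannel N)
    {ρ : Matrix a a ℂ} (h : ρ.PosSemidef) : (N ρ).PosSemidef := by
  obtain ⟨n, K, -, hK⟩ := hN.exists_krausMap
  rw [hK]; exact krausMap_posSemidef _ h

lemma IsChannel.trace {N : Matrix a a ℂ →ₗ[ℂ] Matrix b b ℂ} (hN : IsChannel N)
    (ρ : Matrix a a ℂ) : (N ρ).trace = ρ.trace := by
  obtain ⟨n, K, h1, hK⟩ := hN.exists_krausMap
  rw [hK, trace_krausMap h1]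

lemma IsChannel.isDensity {N : Matrix a a ℂ →ₗ[ℂ] Matrix b b ℂ} (hN : IsChannel N)
    {ρ : Matrix a a ℂ} (h : IsDensity ρ) : IsDensity (N ρ) :=
  ⟨hN.posSemidef h.1, by rw [hN.trace, h.2]⟩

lemma isDensity_complementary {U : Matrix (b × e) a ℂ} (hU : Uᴴ * U = 1)
    {ρ : Matrix a a ℂ} (h : IsDensity ρ) : IsDensity (complementary U ρ) :=
  ⟨complementary_posSemidef U h.1, by rw [trace_complementary hU, h.2]⟩

/-- The environment output of a purified input has the entropy of the complementary state of the
output and the purifying system, which depends on the channel only. -/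
lemma entropy_complementary_mul_conjTranspose {r : Type*} [Fintype r] [DecidableEq r]
    {N : Matrix a a ℂ →ₗ[ℂ] Matrix b b ℂ} {U : Matrix (b × e) a ℂ}
    (hU : IsIsometricExtension U N) (A : Matrix a r ℂ) :
    entropy (complementary U (A * Aᴴ)) =
      entropy (of fun i j : b × r => N (A * Matrix.single j.2 i.2 (1 : ℂ) * Aᴴ) j.1 i.1) := by
  -- `W` is `U * A` reshaped as a map from output and reference to environment. `W * Wᴴ` is the
  -- environment state, and `Wᴴ * W` is the transposed joint state of output and reference.
  let W : Matrix e (b × r) ℂ := of fun i k => (U * A) (k.1, i) k.2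
  have h1 : complementary U (A * Aᴴ) = W * Wᴴ := by
    ext i j
    have : U * (A * Aᴴ) * Uᴴ = (U * A) * (U * A)ᴴ := by
      simp only [conjTranspose_mul, Matrix.mul_assoc]
    simp only [complementary, traceFst, this, of_apply, Matrix.mul_apply (M := U * A),
      Matrix.mul_apply (M := W), Fintype.sum_prod_type, conjTranspose_apply, W]
  have h2 : (of fun i j : b × r => N (A * Matrix.single j.2 i.2 (1 : ℂ) * Aᴴ) j.1 i.1) =
      Wᴴ * W := by
    ext ⟨k, i⟩ ⟨l, j⟩
    have : U * (A * Matrix.single j i (1 : ℂ) * Aᴴ) * Uᴴ =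
        (U * A) * Matrix.single j i (1 : ℂ) * (U * A)ᴴ := by
      simp only [conjTranspose_mul, Matrix.mul_assoc]
    simp only [hU.2, traceSnd, this, of_apply, Matrix.mul_apply (M := Wᴴ), conjTranspose_apply, W]
    refine Finset.sum_congr rfl fun z _ => ?_
    rw [Matrix.mul_apply, Finset.sum_eq_single i]
    · simp [mul_comm]
    · intro t _ ht
      simp [ht]
    · simp
  rw [h1, h2, entropy_mul_conjTranspose]

-- Factor `ρ` as `A * Aᴴ`: the preceding formula then expresses both entropies through `N` alone.
open scoped Matrix.Norms.L2Operator MatrixOrder in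
lemma entropy_complementary_congr {e' : Type*} [Fintype e'] [DecidableEq e']
    {N : Matrix a a ℂ →ₗ[ℂ] Matrix b b ℂ} {U : Matrix (b × e) a ℂ} {V : Matrix (b × e') a ℂ}
    (hU : IsIsometricExtension U N) (hV : IsIsometricExtension V N) {ρ : Matrix a a ℂ}
    (h : ρ.PosSemidef) : entropy (complementary U ρ) = entropy (complementary V ρ) := by
  obtain ⟨B, rfl⟩ := CStarAlgebra.nonneg_iff_eq_star_mul_self.mp h.nonneg
  have h1 := entropy_complementary_mul_conjTranspose hU Bᴴ
  have h2 := entropy_complementary_mul_conjTranspose hV Bᴴ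
  rw [conjTranspose_conjTranspose] at h1 h2
  exact h1.trans h2.symm

/-- A pure input needs only a one-dimensional reference, so the joint state is the output itself, up
to transposition. -/
lemma entropy_complementary_vecMulVec {N : Matrix a a ℂ →ₗ[ℂ] Matrix b b ℂ}
    (hN : IsChannel N) {U : Matrix (b × e) a ℂ} (hU : IsIsometricExtension U N) (φ : a → ℂ) :
    entropy (complementary U (vecMulVec φ (star φ))) = entropy (N (vecMulVec φ (star φ))) := by
  have hφ : vecMulVec φ (star φ) = replicateCol Unit φ * (replicateCol Unit φ)ᴴ := by
    rw [conjTranspose_replicateCol, vecMulVec_eq Unit]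
  have hp : (vecMulVec φ (star φ)).PosSemidef := posSemidef_vecMulVec_self_star φ
  rw [hφ, entropy_complementary_mul_conjTranspose hU, ← hφ,
    ← entropy_transpose (hN.posSemidef hp).isHermitian,
    ← entropy_submatrix (hN.posSemidef hp).isHermitian.transpose (Equiv.prodPUnit b)]
  congr 1
  ext ⟨i, u⟩ ⟨j, v⟩
  have : Matrix.single v u (1 : ℂ) = 1 := by
    ext; simp [Matrix.single]
  simp [this, vecMulVec_eq Unit]

lemma real_smul_vecMulVec {c : ℝ} (hc : 0 ≤ c) (v : a → ℂ) :
    (c : ℂ) • vecMulVec v (star v) =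
      vecMulVec (((Real.sqrt c : ℝ) : ℂ) • v) (star (((Real.sqrt c : ℝ) : ℂ) • v)) := by
  ext i j
  have : ((Real.sqrt c : ℝ) : ℂ) * ((Real.sqrt c : ℝ) : ℂ) = c := by
    rw [← Complex.ofReal_mul, Real.mul_self_sqrt hc]
  simp only [Matrix.smul_apply, vecMulVec_apply, Pi.smul_apply, Pi.star_apply, smul_eq_mul,
    star_mul', Complex.star_def, Complex.conj_ofReal]
  rw [← this]
  ring

lemma IsPure.isDensity {ρ : Matrix a a ℂ} (h : IsPure ρ) : IsDensity ρ := by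
  obtain ⟨ψ, h1, rfl⟩ := h
  refine ⟨posSemidef_vecMulVec_self_star ψ, ?_⟩
  rw [trace_vecMulVec, dotProduct_comm, h1]

lemma entropy_complementary_smul_pure {N : Matrix a a ℂ →ₗ[ℂ] Matrix b b ℂ}
    (hN : IsChannel N) {U : Matrix (b × e) a ℂ} (hU : IsIsometricExtension U N)
    {ψ : Matrix a a ℂ} (hψ : IsPure ψ) {c : ℝ} (hc : 0 ≤ c) :
    entropy (complementary U ((c : ℂ) • ψ)) = entropy (N ((c : ℂ) • ψ)) := by
  obtain ⟨v, -, rfl⟩ := hψ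
  rw [real_smul_vecMulVec hc, entropy_complementary_vecMulVec hN hU]

/-- Every positive semidefinite matrix is a nonnegative combination of pure states. -/
lemma exists_pure_decomposition {ρ : Matrix a a ℂ} (h : ρ.PosSemidef) :
    ∃ (q : a → ℝ) (ψ : a → Matrix a a ℂ), (∀ z, 0 ≤ q z) ∧ (∀ z, IsPure (ψ z)) ∧
      ρ = ∑ z, (q z : ℂ) • ψ z := by
  set P := (h.isHermitian.eigenvectorUnitary : Matrix a a ℂ) with hP
  refine ⟨h.isHermitian.eigenvalues, fun z => vecMulVec (fun i => P i z) (star fun i => P i z),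
    h.eigenvalues_nonneg, fun z => ⟨_, ?_, rfl⟩, ?_⟩
  · have := congrFun (congrFun (eigenvectorUnitary_conjTranspose_mul h.isHermitian) z) z
    rw [one_apply_eq] at this
    exact this
  · conv_lhs => rw [eigen_decomp h.isHermitian]
    ext i j
    rw [Matrix.mul_apply, Matrix.sum_apply]
    refine Finset.sum_congr rfl fun z _ => ?_
    simp only [mul_diagonal, conjTranspose_apply, Matrix.smul_apply, vecMulVec_apply,
      Pi.star_apply, smul_eq_mul, ← hP]
    ring

/-- Degradability is assumed on density operators; pure decompositions and linearity extend it to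
the unnormalised states used below. -/
lemma IsDegradable.exists_krausMap {N : Matrix a a ℂ →ₗ[ℂ] Matrix b b ℂ} (hd : IsDegradable N) :
    ∃ (n k : ℕ) (V : Matrix (b × Fin n) a ℂ) (K : Fin k → Matrix (Fin n) b ℂ),
      IsIsometricExtension V N ∧ ∑ i, (K i)ᴴ * K i = 1 ∧
        ∀ ρ, ρ.PosSemidef → krausMap K (N ρ) = complementary V ρ := by
  obtain ⟨n, V, hV, D, hD, h⟩ := hd
  obtain ⟨k, K, hK, hDK⟩ := hD.exists_krausMap
  refine ⟨n, k, V, K, hV, hK, fun ρ hρ => ?_⟩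
  obtain ⟨q, ψ, hq, hψ, rfl⟩ := exists_pure_decomposition hρ
  simp only [map_sum, map_smul, krausMap_sum, krausMap_smul, complementary_sum,
    complementary_smul]
  exact Finset.sum_congr rfl fun z _ => by rw [← hDK, h _ (hψ z).isDensity]

/-- The coherent information of a degradable channel is nonnegative. -/
lemma entropy_complementary_le {N : Matrix a a ℂ →ₗ[ℂ] Matrix b b ℂ} (hN : IsChannel N)
    (hd : IsDegradable N) {U : Matrix (b × e) a ℂ} (hU : IsIsometricExtension U N)
    {ρ : Matrix a a ℂ} (h : ρ.PosSemidef) : entropy (complementary U ρ) ≤ entropy (N ρ) := by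
  obtain ⟨n, k, V, K, hV, hK, hKN⟩ := hd.exists_krausMap
  rw [entropy_complementary_congr hU hV h]
  obtain ⟨q, ψ, hq, hψ, rfl⟩ := exists_pure_decomposition h
  have hp : ∀ z, ((q z : ℂ) • ψ z).PosSemidef := fun z =>
    (hψ z).isDensity.1.smul (by exact_mod_cast hq z)
  -- Degrading the outputs of the pure members gives the environment states; member entropies then
  -- cancel on both sides.
  have := holevo_krausMap_le hK (A := fun z => N ((q z : ℂ) • ψ z)) fun z => hN.posSemidef (hp z)
  simp only [fun z => hKN _ (hp z), fun z => entropy_complementary_smul_pure hN hV (hψ z) (hq z),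
    ← complementary_sum, ← map_sum] at this
  linarith

end Channels
end PrivateDynamic

namespace PrivateDynamic

/-! ### Entropies of classical-quantum states and comparison of the objectives -/

section CQ

variable {X Y a b e : Type*} [Fintype X] [DecidableEq X] [Fintype Y] [DecidableEq Y]
  [Fintype a] [DecidableEq a] [Fintype b] [DecidableEq b] [Fintype e] [DecidableEq e]
  {N : Matrix a a ℂ →ₗ[ℂ] Matrix b b ℂ} {U : Matrix (b × e) a ℂ} {p : X → Y → ℝ}
  {ρ : X → Y → Matrix a a ℂ}

lemma cqState_apply (U : Matrix (b × e) a ℂ) (p : X → Y → ℝ) (ρ : X → Y → Matrix a a ℂ)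
    (x x' : X) (y y' : Y) (k k' : b × e) :
    cqState U p ρ (x, y, k) (x', y', k') =
      if x = x' then if y = y' then (p x y : ℂ) * (U * ρ x y * Uᴴ) k k' else 0 else 0 := by
  simp only [cqState, Matrix.sum_apply, Matrix.smul_apply, kroneckerMap_apply, Matrix.single_apply,
    smul_eq_mul, ite_and]
  rw [Finset.sum_eq_single x, Finset.sum_eq_single y]
  · by_cases hx : x = x' <;> by_cases hy : y = y' <;> simp [hx, hy]
  · intro z _ hz; simp [hz]
  · simp
  · intro z _ hz; simp [hz]
  · simp

/-- Probabilities stay inside the argument of the channel, so letters of probability zero need no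
separate treatment. -/
lemma redXYB_cqState (hU : IsIsometricExtension U N) :
    redXYB (cqState U p ρ) = (blockOp fun z : X × Y => N ((p z.1 z.2 : ℂ) • ρ z.1 z.2)).submatrix
      (Equiv.prodAssoc X Y b).symm (Equiv.prodAssoc X Y b).symm := by
  ext ⟨x, y, k⟩ ⟨x', y', k'⟩
  by_cases hx : x = x' <;> by_cases hy : y = y' <;>
    simp [redXYB, blockOp, cqState_apply, hx, hy, hU.2, traceSnd]

lemma redXYE_cqState :
    redXYE (cqState U p ρ) = (blockOp fun z : X × Y =>
      complementary U ((p z.1 z.2 : ℂ) • ρ z.1 z.2)).submatrix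
      (Equiv.prodAssoc X Y e).symm (Equiv.prodAssoc X Y e).symm := by
  ext ⟨x, y, k⟩ ⟨x', y', k'⟩
  by_cases hx : x = x' <;> by_cases hy : y = y' <;>
    simp [redXYE, blockOp, cqState_apply, hx, hy]
  all_goals simp [complementary, traceFst]

lemma redXB_cqState (hU : IsIsometricExtension U N) :
    redXB (cqState U p ρ) = blockOp fun x : X => N (∑ y, (p x y : ℂ) • ρ x y) := by
  ext ⟨x, k⟩ ⟨x', k'⟩
  simp only [map_sum, map_smul]
  by_cases hx : x = x' <;>
    simp [redXB, blockOp, cqState_apply, hx, hU.2, traceSnd, Finset.mul_sum, Matrix.sum_apply]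

lemma redXE_cqState :
    redXE (cqState U p ρ) = blockOp fun x : X => complementary U (∑ y, (p x y : ℂ) • ρ x y) := by
  ext ⟨x, k⟩ ⟨x', k'⟩
  by_cases hx : x = x' <;>
    simp [redXE, blockOp, cqState_apply, hx, complementary_sum, Matrix.sum_apply]
  all_goals simp [complementary, traceFst]

lemma redB_cqState (hU : IsIsometricExtension U N) :
    redB (cqState U p ρ) = N (∑ x, ∑ y, (p x y : ℂ) • ρ x y) := by
  ext k k'
  simp only [map_sum, map_smul]
  simp [redB, cqState_apply, hU.2, traceSnd, Finset.mul_sum, Matrix.sum_apply]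

lemma trace_conj_isometry (hU : Uᴴ * U = 1) (σ : Matrix a a ℂ) :
    ∑ k, ∑ j, (U * σ * Uᴴ) (k, j) (k, j) = σ.trace := by
  have : (U * σ * Uᴴ).trace = σ.trace := by
    rw [Matrix.trace_mul_comm, ← Matrix.mul_assoc, hU, Matrix.one_mul]
  rw [← this, Matrix.trace, Fintype.sum_prod_type]
  rfl

lemma redXY_cqState (hU : IsIsometricExtension U N) (hρ : ∀ x y, (ρ x y).trace = 1) :
    redXY (cqState U p ρ) = diagonal fun z : X × Y => (p z.1 z.2 : ℂ) := by
  ext ⟨x, y⟩ ⟨x', y'⟩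
  by_cases hx : x = x' <;> by_cases hy : y = y' <;>
    simp [redXY, cqState_apply, hx, hy, ← Finset.mul_sum, trace_conj_isometry hU.1, hρ]

lemma redX_cqState (hU : IsIsometricExtension U N) (hρ : ∀ x y, (ρ x y).trace = 1) :
    redX (cqState U p ρ) = diagonal fun x : X => ((∑ y, p x y : ℝ) : ℂ) := by
  ext x x'
  by_cases hx : x = x' <;>
    simp [redX, cqState_apply, hx, ← Finset.mul_sum, trace_conj_isometry hU.1, hρ]

lemma posSemidef_real_smul {c : ℝ} (hc : 0 ≤ c) {σ : Matrix a a ℂ} (h : σ.PosSemidef) :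
    ((c : ℂ) • σ).PosSemidef :=
  h.smul (by exact_mod_cast hc)

lemma entropy_redXYB (hN : IsChannel N) (hU : IsIsometricExtension U N)
    (hp : ∀ x y, 0 ≤ p x y) (hρ : ∀ x y, IsDensity (ρ x y)) : entropy (redXYB (cqState U p ρ)) =
    ∑ x, ∑ y, entropy (N ((p x y : ℂ) • ρ x y)) := by
  have h : ∀ z : X × Y, (N ((p z.1 z.2 : ℂ) • ρ z.1 z.2)).IsHermitian := fun z =>
    (hN.posSemidef (posSemidef_real_smul (hp z.1 z.2) (hρ z.1 z.2).1)).isHermitian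
  have hb : (blockOp fun z : X × Y => N ((p z.1 z.2 : ℂ) • ρ z.1 z.2)).IsHermitian :=
    isHermitian_blockOp h
  rw [redXYB_cqState hU, entropy_submatrix hb, entropy_blockOp h, Fintype.sum_prod_type]

lemma entropy_redXYE (hp : ∀ x y, 0 ≤ p x y) (hρ : ∀ x y, IsDensity (ρ x y)) :
    entropy (redXYE (cqState U p ρ)) =
    ∑ x, ∑ y, entropy (complementary U ((p x y : ℂ) • ρ x y)) := by
  have h : ∀ z : X × Y, (complementary U ((p z.1 z.2 : ℂ) • ρ z.1 z.2)).IsHermitian := fun z =>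
    (complementary_posSemidef U (posSemidef_real_smul (hp z.1 z.2) (hρ z.1 z.2).1)).isHermitian
  rw [redXYE_cqState, entropy_submatrix (isHermitian_blockOp h), entropy_blockOp h,
    Fintype.sum_prod_type]

lemma posSemidef_sum_smul (hp : ∀ x y, 0 ≤ p x y) (hρ : ∀ x y, IsDensity (ρ x y)) (x : X) :
    (∑ y, (p x y : ℂ) • ρ x y).PosSemidef :=
  posSemidef_sum _ fun y _ => posSemidef_real_smul (hp x y) (hρ x y).1

lemma entropy_redXB (hN : IsChannel N) (hU : IsIsometricExtension U N)
    (hp : ∀ x y, 0 ≤ p x y) (hρ : ∀ x y, IsDensity (ρ x y)) : entropy (redXB (cqState U p ρ)) =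
    ∑ x, entropy (N (∑ y, (p x y : ℂ) • ρ x y)) := by
  rw [redXB_cqState hU, entropy_blockOp fun x =>
    (hN.posSemidef (posSemidef_sum_smul hp hρ x)).isHermitian]

lemma entropy_redXE (hp : ∀ x y, 0 ≤ p x y) (hρ : ∀ x y, IsDensity (ρ x y)) :
    entropy (redXE (cqState U p ρ)) =
    ∑ x, entropy (complementary U (∑ y, (p x y : ℂ) • ρ x y)) := by
  rw [redXE_cqState, entropy_blockOp fun x =>
    (complementary_posSemidef U (posSemidef_sum_smul hp hρ x)).isHermitian]

lemma entropy_redXY (hU : IsIsometricExtension U N) (hρ : ∀ x y, IsDensity (ρ x y)) :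
    entropy (redXY (cqState U p ρ)) = ∑ x, ∑ y, eta (p x y) := by
  rw [redXY_cqState hU fun x y => (hρ x y).2, entropy_diagonal fun z : X × Y => p z.1 z.2,
    Fintype.sum_prod_type]

lemma entropy_redX (hU : IsIsometricExtension U N) (hρ : ∀ x y, IsDensity (ρ x y)) :
    entropy (redX (cqState U p ρ)) = ∑ x, eta (∑ y, p x y) := by
  rw [redX_cqState hU fun x y => (hρ x y).2, entropy_diagonal fun x => ∑ y, p x y]

lemma pureObjective_cqState (hN : IsChannel N) (hU : IsIsometricExtension U N)
    (hp : ∀ x y, 0 ≤ p x y) (hρ : ∀ x y, IsDensity (ρ x y)) (l m : ℝ) :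
    pureObjective l m (cqState U p ρ) =
    ∑ x, ∑ y, eta (p x y) + entropy (N (∑ x, ∑ y, (p x y : ℂ) • ρ x y)) -
        ∑ x, ∑ y, entropy (N ((p x y : ℂ) • ρ x y)) +
      l * (∑ x, entropy (N (∑ y, (p x y : ℂ) • ρ x y)) -
        ∑ x, entropy (complementary U (∑ y, (p x y : ℂ) • ρ x y))) +
      m * (entropy (N (∑ x, ∑ y, (p x y : ℂ) • ρ x y)) -
        (∑ x, entropy (complementary U (∑ y, (p x y : ℂ) • ρ x y)) - ∑ x, eta (∑ y, p x y))) := by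
  rw [pureObjective, mutInfoYXB, condEntBX, condEntEX, entB, entropy_redXYB hN hU hp hρ,
    entropy_redXB hN hU hp hρ, entropy_redXE hp hρ, entropy_redXY hU hρ,
    entropy_redX hU hρ, redB_cqState hU]
  ring

/-- Each of the two brackets weighted by `l` and `m` loses `H(B|XY) - H(E|XY)` relative to its
simplified counterpart. In this difference the entropy of `XY` cancels. -/
lemma privateObjective_cqState (hN : IsChannel N) (hU : IsIsometricExtension U N)
    (hp : ∀ x y, 0 ≤ p x y) (hρ : ∀ x y, IsDensity (ρ x y)) (l m : ℝ) :
    privateObjective l m (cqState U p ρ) =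
    pureObjective l m (cqState U p ρ) - (l + m) * (∑ x, ∑ y, entropy (N ((p x y : ℂ) • ρ x y)) -
      ∑ x, ∑ y, entropy (complementary U ((p x y : ℂ) • ρ x y))) := by
  rw [privateObjective, condMutInfoYBX, condMutInfoYEX, pureObjective, mutInfoYXB, condEntBX,
    condEntEX, entB, entropy_redXYB hN hU hp hρ, entropy_redXYE hp hρ]
  ring

/-- Pure ensembles over arbitrary finite alphabets realise values of the simplified formula. -/
lemma pureObjective_mem_pureValues (hN : IsChannel N) (hU : IsIsometricExtension U N)
    (hp : IsJointDistribution p) (hρ : ∀ x y, IsPure (ρ x y)) (l m : ℝ) :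
    pureObjective l m (cqState U p ρ) ∈ pureValues U l m := by
  let f := (Fintype.equivFin X).symm
  let g := (Fintype.equivFin Y).symm
  have hp' : IsJointDistribution fun i j => p (f i) (g j) := by
    refine ⟨fun i j => hp.1 _ _, ?_⟩
    rw [f.sum_comp fun x => ∑ j, p x (g j), ← hp.2]
    exact Finset.sum_congr rfl fun x _ => g.sum_comp fun y => p x y
  refine ⟨_, _, fun i j => p (f i) (g j), fun i j => ρ (f i) (g j), hp', fun i j => hρ _ _, ?_⟩
  rw [pureObjective_cqState hN hU hp.1 fun x y => (hρ x y).isDensity,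
    pureObjective_cqState hN hU hp'.1 fun x y => (hρ _ _).isDensity]
  have e1 : ∀ (M : Type) [AddCommMonoid M] (h : X → Y → M),
      ∑ i, ∑ j, h (f i) (g j) = ∑ x, ∑ y, h x y := by
    intro M _ h
    rw [f.sum_comp fun x => ∑ j, h x (g j)]
    exact Finset.sum_congr rfl fun x _ => g.sum_comp fun y => h x y
  have e2 : ∀ x, ∑ j, (p x (g j) : ℂ) • ρ x (g j) = ∑ y, (p x y : ℂ) • ρ x y :=
    fun x => g.sum_comp fun y => (p x y : ℂ) • ρ x y
  have e3 : ∀ x, ∑ j, p x (g j) = ∑ y, p x y := fun x => g.sum_comp fun y => p x y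
  rw [e1 _ fun x y => eta (p x y), e1 _ fun x y => entropy (N ((p x y : ℂ) • ρ x y))]
  simp only [e2, e3]
  rw [f.sum_comp fun x => ∑ y, (p x y : ℂ) • ρ x y,
    f.sum_comp fun x => entropy (N (∑ y, (p x y : ℂ) • ρ x y)),
    f.sum_comp fun x => entropy (complementary U (∑ y, (p x y : ℂ) • ρ x y)),
    f.sum_comp fun x => eta (∑ y, p x y)]

lemma pureValues_subset_privateValues (hN : IsChannel N) (hU : IsIsometricExtension U N)
    (l m : ℝ) : pureValues U l m ⊆ privateValues U l m := by
  rintro _ ⟨r, s, p, ψ, hp, hψ, rfl⟩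
  refine ⟨r, s, p, ψ, hp, fun x y => (hψ x y).isDensity, ?_⟩
  rw [privateObjective_cqState hN hU hp.1 fun x y => (hψ x y).isDensity]
  simp only [fun x y => entropy_complementary_smul_pure hN hU (hψ x y) (hp.1 x y), sub_self,
    mul_zero, sub_zero]

/-- Splitting every input state into pure states does not decrease the objective. -/
lemma exists_pureValue_ge (hN : IsChannel N) (hd : IsDegradable N)
    (hU : IsIsometricExtension U N) {l m : ℝ} (hl : 0 ≤ l) (hm : 0 ≤ m) {v : ℝ}
    (hv : v ∈ privateValues U l m) : ∃ w ∈ pureValues U l m, v ≤ w := by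
  obtain ⟨r, s, p, ρ, hp, hρ, rfl⟩ := hv
  choose q ψ hq hψ hρψ using fun x y => exists_pure_decomposition (hρ x y).1
  have hq1 : ∀ x y, ∑ z, q x y z = 1 := by
    intro x y
    have h := (hρ x y).2
    rw [hρψ x y, trace_sum] at h
    simp only [trace_smul, (hψ _ _ _).isDensity.2, smul_eq_mul, mul_one] at h
    exact_mod_cast h
  -- The eigenvector label is appended to `Y`; the marginal on `X` and the average input for each
  -- `x` are unchanged.
  let p' : Fin r → Fin s × a → ℝ := fun x w => p x w.1 * q x w.1 w.2
  have hp' : IsJointDistribution p' := by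
    refine ⟨fun x w => mul_nonneg (hp.1 _ _) (hq _ _ _), ?_⟩
    simp only [p', Fintype.sum_prod_type, ← Finset.mul_sum, hq1, mul_one]
    exact hp.2
  refine ⟨_, pureObjective_mem_pureValues (p := p') (ρ := fun x w => ψ x w.1 w.2) hN hU hp'
    (fun x w => hψ x w.1 w.2) l m, ?_⟩
  have hsplit : ∀ x y, (p x y : ℂ) • ρ x y = ∑ z, (p' x (y, z) : ℂ) • ψ x y z := by
    intro x y
    rw [hρψ x y, Finset.smul_sum]
    exact Finset.sum_congr rfl fun z _ => by rw [smul_smul, ← Complex.ofReal_mul]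
  have hsum : ∀ x, ∑ w, (p' x w : ℂ) • ψ x w.1 w.2 = ∑ y, (p x y : ℂ) • ρ x y := by
    intro x
    rw [Fintype.sum_prod_type]
    exact Finset.sum_congr rfl fun y _ => (hsplit x y).symm
  have hmarg : ∀ x, ∑ w, p' x w = ∑ y, p x y := by
    intro x
    simp only [p', Fintype.sum_prod_type, ← Finset.mul_sum, hq1, mul_one]
  rw [privateObjective_cqState hN hU hp.1 hρ, pureObjective_cqState hN hU hp.1 hρ,
    pureObjective_cqState hN hU hp'.1 fun x w => (hψ x w.1 w.2).isDensity]
  simp only [hsum, hmarg]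
  have h1 : 0 ≤ (l + m) * (∑ x, ∑ y, entropy (N ((p x y : ℂ) • ρ x y)) -
      ∑ x, ∑ y, entropy (complementary U ((p x y : ℂ) • ρ x y))) := by
    refine mul_nonneg (add_nonneg hl hm) (sub_nonneg.mpr ?_)
    exact Finset.sum_le_sum fun x _ => Finset.sum_le_sum fun y _ =>
      entropy_complementary_le hN hd hU (posSemidef_real_smul (hp.1 x y) (hρ x y).1)
  have h2 : ∑ x, ∑ y, eta (p x y) - ∑ x, ∑ y, entropy (N ((p x y : ℂ) • ρ x y)) ≤
      ∑ x, ∑ w, eta (p' x w) - ∑ x, ∑ w, entropy (N ((p' x w : ℂ) • ψ x w.1 w.2)) := by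
    simp only [Fintype.sum_prod_type, ← Finset.sum_sub_distrib]
    refine Finset.sum_le_sum fun x _ => Finset.sum_le_sum fun y _ => ?_
    -- Concavity for the single pair `(x, y)`; the `eta` of the traces are exactly the entropies of
    -- the classical labels.
    have h := sum_entropy_sub_le (A := fun z => N ((p' x (y, z) : ℂ) • ψ x y z)) fun z =>
      hN.posSemidef (posSemidef_real_smul (hp'.1 x (y, z)) (hψ x y z).isDensity.1)
    simp only [← map_sum, ← hsplit, hN.trace, trace_smul, (hψ _ _ _).isDensity.2, (hρ x y).2,
      smul_eq_mul, mul_one, Complex.ofReal_re, Finset.sum_sub_distrib] at h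
    rw [Finset.sum_sub_distrib]
    linarith
  linarith

end CQ
end PrivateDynamic

/-! ### Compactness and attainment of the maximum -/

namespace PrivateDynamic

/-- In finite dimension the convex hull of a compact set is compact. -/
lemma isCompact_convexHull_of_finiteDimensional {V : Type*} [AddCommGroup V] [Module ℝ V]
    [TopologicalSpace V] [IsTopologicalAddGroup V] [ContinuousSMul ℝ V] [FiniteDimensional ℝ V]
    {s : Set V} (hs : IsCompact s) : IsCompact (convexHull ℝ s) := by
  -- By Carathéodory `finrank + 1` points suffice, so `k` ranges below `finrank + 2`. The term `k =
  -- 0` is empty, its simplex being empty.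
  have h : convexHull ℝ s = ⋃ k : Fin (Module.finrank ℝ V + 2),
      (fun q : (Fin k → ℝ) × (Fin k → V) => ∑ i, q.1 i • q.2 i) ''
        (stdSimplex ℝ (Fin k) ×ˢ Set.pi Set.univ fun _ => s) := by
    ext x
    simp only [Set.mem_iUnion, Set.mem_image, Set.mem_prod, Set.mem_pi, Set.mem_univ,
      true_imp_iff]
    constructor
    · intro hx
      obtain ⟨ι, _, z, w, hz, haff, hw, hw1, rfl⟩ := eq_pos_convex_span_of_mem_convexHull hx
      have hcard := haff.card_le_finrank_succ
      have hle : Module.finrank ℝ (vectorSpan ℝ (Set.range z)) ≤ Module.finrank ℝ V :=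
        Submodule.finrank_le _
      let f := (Fintype.equivFin ι).symm
      refine ⟨⟨Fintype.card ι, by omega⟩, (w ∘ f, z ∘ f), ⟨⟨fun i => (hw _).le, ?_⟩, ?_⟩, ?_⟩
      · exact (f.sum_comp w).trans hw1
      · exact fun i => hz ⟨_, rfl⟩
      · exact f.sum_comp fun i => w i • z i
    · rintro ⟨k, q, ⟨hq1, hq2⟩, rfl⟩
      exact mem_convexHull_of_exists_fintype q.1 q.2 hq1.1 hq1.2 hq2 rfl
  rw [h]
  refine isCompact_iUnion fun k => IsCompact.image ?_ (by fun_prop)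
  exact (isCompact_stdSimplex ℝ _).prod (isCompact_univ_pi fun _ => hs)

section Maximum

variable {X Y a b e : Type*} [Fintype X] [DecidableEq X] [Fintype Y] [DecidableEq Y]
  [Fintype a] [DecidableEq a] [Fintype b] [DecidableEq b] [Fintype e] [DecidableEq e]

lemma isCompact_isPure : IsCompact {ρ : Matrix a a ℂ | IsPure ρ} := by
  have h : {ρ : Matrix a a ℂ | IsPure ρ} =
      (fun ψ : a → ℂ => vecMulVec ψ (star ψ)) '' {ψ | star ψ ⬝ᵥ ψ = 1} := by
    ext ρ
    exact ⟨fun ⟨ψ, h1, h2⟩ => ⟨ψ, h1, h2.symm⟩, fun ⟨ψ, h1, h2⟩ => ⟨ψ, h1, h2.symm⟩⟩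
  rw [h]
  refine IsCompact.image ?_ (by fun_prop)
  -- The norm on `a → ℂ` is the supremum norm, so the Euclidean unit sphere is only a closed subset
  -- of the ball.
  refine (isCompact_closedBall (0 : a → ℂ) 1).of_isClosed_subset ?_ ?_
  · exact isClosed_eq (by simp only [dotProduct]; fun_prop) continuous_const
  · intro ψ hψ
    rw [mem_closedBall_zero_iff, pi_norm_le_iff_of_nonneg zero_le_one]
    intro i
    have h1 : ∑ j, ‖ψ j‖ ^ 2 = 1 := by
      have : star ψ ⬝ᵥ ψ = ((∑ j, ‖ψ j‖ ^ 2 : ℝ) : ℂ) := by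
        simp only [dotProduct, Pi.star_apply, Complex.star_def, Complex.conj_mul',
          Complex.ofReal_sum,
          Complex.ofReal_pow]
      rw [Set.mem_ofPred_eq, this] at hψ
      exact_mod_cast hψ
    have h2 : ‖ψ i‖ ^ 2 ≤ 1 := by
      rw [← h1]
      exact Finset.single_le_sum (f := fun j => ‖ψ j‖ ^ 2) (fun j _ => sq_nonneg _)
        (Finset.mem_univ i)
    exact (sq_le_one_iff₀ (norm_nonneg _)).mp h2

lemma convex_isDensity : Convex ℝ {ρ : Matrix a a ℂ | IsDensity ρ} := by
  intro ρ hρ σ hσ s t hs ht hst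
  refine ⟨?_, ?_⟩
  · have h := (posSemidef_real_smul hs hρ.1).add (posSemidef_real_smul ht hσ.1)
    simpa only [Complex.coe_smul] using h
  · rw [trace_add, trace_smul, trace_smul, hρ.2, hσ.2, ← add_smul, hst, one_smul]

lemma exists_isPure [Nonempty a] : ∃ ρ : Matrix a a ℂ, IsPure ρ := by
  obtain ⟨i⟩ := ‹Nonempty a›
  exact ⟨_, Pi.single i 1, by simp, rfl⟩

/-- A pure input state together with its output entropy. -/
noncomputable def outputPoint (N : Matrix a a ℂ →ₗ[ℂ] Matrix b b ℂ) (ρ : Matrix a a ℂ) :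
    Matrix a a ℂ × ℝ :=
  (ρ, entropy (N ρ))

/-- The average inputs with the average output entropies of the pure ensembles. -/
def ensembleSet (N : Matrix a a ℂ →ₗ[ℂ] Matrix b b ℂ) : Set (Matrix a a ℂ × ℝ) :=
  convexHull ℝ (outputPoint N '' {ρ | IsPure ρ})

/-- The penalty that an ensemble with average input `z.1` and average output entropy `z.2`
contributes to the simplified objective. -/
noncomputable def penalty (N : Matrix a a ℂ →ₗ[ℂ] Matrix b b ℂ) (U : Matrix (b × e) a ℂ) (l m : ℝ)
    (z : Matrix a a ℂ × ℝ) : Matrix a a ℂ × ℝ :=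
  (z.1, z.2 + l * (entropy (complementary U z.1) - entropy (N z.1)) +
    m * entropy (complementary U z.1))

/-- The simplified objective in terms of the average input and the average penalty. -/
noncomputable def gain (N : Matrix a a ℂ →ₗ[ℂ] Matrix b b ℂ) (m : ℝ) (z : Matrix a a ℂ × ℝ) : ℝ :=
  (1 + m) * entropy (N z.1) - z.2

variable {N : Matrix a a ℂ →ₗ[ℂ] Matrix b b ℂ} {U : Matrix (b × e) a ℂ}

lemma entropy_map_smul (hN : IsChannel N) (c : ℝ) {ρ : Matrix a a ℂ} (hρ : IsDensity ρ) :
    entropy (N ((c : ℂ) • ρ)) = c * entropy (N ρ) + eta c := by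
  rw [map_smul, entropy_smul (hN.posSemidef hρ.1).isHermitian, hN.trace, hρ.2]
  simp

lemma entropy_complementary_smul (hU : IsIsometricExtension U N) (c : ℝ) {ρ : Matrix a a ℂ}
    (hρ : IsDensity ρ) :
    entropy (complementary U ((c : ℂ) • ρ)) = c * entropy (complementary U ρ) + eta c := by
  rw [complementary_smul, entropy_smul (complementary_posSemidef U hρ.1).isHermitian,
    trace_complementary hU.1, hρ.2]
  simp

/-- Here `z x` is the barycentre of the ensemble conditioned on `x`. Stating `h` multiplied by the
marginal of `x` avoids dividing by a zero probability. All `eta` terms cancel, and what remains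
depends on the ensemble only through averages. -/
lemma pureObjective_eq_gain (hN : IsChannel N) (hU : IsIsometricExtension U N) {p : X → Y → ℝ}
    {ψ : X → Y → Matrix a a ℂ} (hp : IsJointDistribution p) (hψ : ∀ x y, IsPure (ψ x y))
    (l m : ℝ) {z : X → Matrix a a ℂ × ℝ} (hz : ∀ x, IsDensity (z x).1)
    (h : ∀ x, ∑ y, p x y • outputPoint N (ψ x y) = (∑ y, p x y) • z x) :
    pureObjective l m (cqState U p ψ) = gain N m (∑ x, (∑ y, p x y) • penalty N U l m (z x)) := by
  have h1 : ∀ x, ∑ y, (p x y : ℂ) • ψ x y = ((∑ y, p x y : ℝ) : ℂ) • (z x).1 := by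
    intro x
    have := congrArg Prod.fst (h x)
    simpa only [Prod.fst_sum, Prod.smul_fst, outputPoint, Complex.coe_smul] using this
  have h2 : ∀ x, ∑ y, p x y * entropy (N (ψ x y)) = (∑ y, p x y) * (z x).2 := by
    intro x
    have := congrArg Prod.snd (h x)
    simpa only [Prod.snd_sum, Prod.smul_snd, outputPoint, smul_eq_mul] using this
  have h3 : (∑ x, (∑ y, p x y) • penalty N U l m (z x)).1 =
      ∑ x, ((∑ y, p x y : ℝ) : ℂ) • (z x).1 := by
    simp only [Prod.fst_sum, Prod.smul_fst, penalty, Complex.coe_smul]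
  have h4 : (∑ x, (∑ y, p x y) • penalty N U l m (z x)).2 =
      ∑ x, (∑ y, p x y) * ((z x).2 + l * (entropy (complementary U (z x).1) - entropy (N (z x).1)) +
        m * entropy (complementary U (z x).1)) := by
    simp only [Prod.snd_sum, Prod.smul_snd, penalty, smul_eq_mul]
  rw [pureObjective_cqState hN hU hp.1 fun x y => (hψ x y).isDensity, gain, h3, h4]
  simp only [h1, fun x y => entropy_map_smul hN (p x y) (hψ x y).isDensity,
    fun x => entropy_map_smul hN (∑ y, p x y) (hz x),
    fun x => entropy_complementary_smul hU (∑ y, p x y) (hz x), Finset.sum_add_distrib, h2,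
    mul_add, mul_sub, Finset.sum_sub_distrib, Finset.mul_sum]
  simp only [mul_left_comm _ l, mul_left_comm _ m]
  ring

lemma isDensity_of_mem_ensembleSet {z : Matrix a a ℂ × ℝ} (hz : z ∈ ensembleSet N) :
    IsDensity z.1 := by
  have h : ensembleSet N ⊆ (LinearMap.fst ℝ (Matrix a a ℂ) ℝ) ⁻¹' {ρ | IsDensity ρ} := by
    refine convexHull_min ?_ (convex_isDensity.linear_preimage _)
    rintro _ ⟨ρ, hρ, rfl⟩
    exact hρ.isDensity
  exact h hz

lemma isDensity_of_mem_convexHull_penalty {l m : ℝ} {z : Matrix a a ℂ × ℝ}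
    (hz : z ∈ convexHull ℝ (penalty N U l m '' ensembleSet N)) : IsDensity z.1 := by
  have h : convexHull ℝ (penalty N U l m '' ensembleSet N) ⊆
      (LinearMap.fst ℝ (Matrix a a ℂ) ℝ) ⁻¹' {ρ | IsDensity ρ} := by
    refine convexHull_min ?_ (convex_isDensity.linear_preimage _)
    rintro _ ⟨w, hw, rfl⟩
    exact isDensity_of_mem_ensembleSet (z := w) hw
  exact h hz

lemma continuousOn_entropy_map (hN : IsChannel N) :
    ContinuousOn (fun ρ => entropy (N ρ)) {ρ | IsDensity ρ} := by
  refine continuousOn_entropy.comp ?_ fun ρ hρ => hN.isDensity hρ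
  exact (LinearMap.continuous_of_finiteDimensional N).continuousOn

lemma continuousOn_entropy_complementary (hU : Uᴴ * U = 1) :
    ContinuousOn (fun ρ => entropy (complementary U ρ)) {ρ | IsDensity ρ} := by
  refine continuousOn_entropy.comp ?_ fun ρ hρ => isDensity_complementary hU hρ
  refine Continuous.continuousOn ?_
  rw [funext (complementary_eq_krausMap U)]
  unfold krausMap
  fun_prop

lemma isCompact_ensembleSet (hN : IsChannel N) : IsCompact (ensembleSet N) := by
  refine isCompact_convexHull_of_finiteDimensional (isCompact_isPure.image_of_continuousOn ?_)
  exact continuousOn_id.prodMk ((continuousOn_entropy_map hN).mono fun ρ hρ => hρ.isDensity)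

lemma isCompact_convexHull_penalty (hN : IsChannel N) (hU : IsIsometricExtension U N) (l m : ℝ) :
    IsCompact (convexHull ℝ (penalty N U l m '' ensembleSet N)) := by
  refine isCompact_convexHull_of_finiteDimensional
    ((isCompact_ensembleSet hN).image_of_continuousOn ?_)
  have hm : Set.MapsTo Prod.fst (ensembleSet N) {ρ : Matrix a a ℂ | IsDensity ρ} :=
    fun z hz => isDensity_of_mem_ensembleSet hz
  have h1 := (continuousOn_entropy_map hN).comp continuous_fst.continuousOn hm
  have h2 := (continuousOn_entropy_complementary hU.1).comp continuous_fst.continuousOn hm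
  exact continuous_fst.continuousOn.prodMk ((continuous_snd.continuousOn.add
    (continuousOn_const.mul (h2.sub h1))).add (continuousOn_const.mul h2))

lemma ensembleSet_nonempty [Nonempty a] : (ensembleSet N).Nonempty := by
  obtain ⟨ρ, hρ⟩ := exists_isPure (a := a)
  exact ⟨_, subset_convexHull ℝ _ ⟨ρ, hρ, rfl⟩⟩

lemma exists_isMaxOn_gain [Nonempty a] (hN : IsChannel N) (hU : IsIsometricExtension U N)
    (l m : ℝ) : ∃ z ∈ convexHull ℝ (penalty N U l m '' ensembleSet N),
      IsMaxOn (gain N m) (convexHull ℝ (penalty N U l m '' ensembleSet N)) z := by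
  refine (isCompact_convexHull_penalty hN hU l m).exists_isMaxOn
    ((ensembleSet_nonempty.image _).convexHull) ?_
  have hm : Set.MapsTo Prod.fst (convexHull ℝ (penalty N U l m '' ensembleSet N))
      {ρ : Matrix a a ℂ | IsDensity ρ} := fun z hz => isDensity_of_mem_convexHull_penalty hz
  exact (continuousOn_const.mul ((continuousOn_entropy_map hN).comp
    continuous_fst.continuousOn hm)).sub continuous_snd.continuousOn

/-- Normalise the weights; if their total is zero, any point of `s` serves. -/
lemma exists_smul_eq_sum_smul {V : Type*} [AddCommGroup V] [Module ℝ V] {s : Set V}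
    (hs : Convex ℝ s) (hne : s.Nonempty) {w : Y → ℝ} (hw : ∀ y, 0 ≤ w y) {z : Y → V}
    (hz : ∀ y, z y ∈ s) : ∃ v ∈ s, ∑ y, w y • z y = (∑ y, w y) • v := by
  by_cases h : ∑ y, w y = 0
  · obtain ⟨v, hv⟩ := hne
    refine ⟨v, hv, ?_⟩
    have h0 := (Finset.sum_eq_zero_iff_of_nonneg fun y _ => hw y).mp h
    rw [h, zero_smul]
    exact Finset.sum_eq_zero fun y hy => by rw [h0 y hy, zero_smul]
  · refine ⟨_, hs.sum_mem (t := Finset.univ) (w := fun y => (∑ y, w y)⁻¹ * w y) (z := z)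
      (fun y _ => mul_nonneg (inv_nonneg.mpr (Finset.sum_nonneg fun y _ => hw y)) (hw y))
      (by rw [← Finset.mul_sum, inv_mul_cancel₀ h]) fun y _ => hz y, ?_⟩
    simp only [Finset.smul_sum, smul_smul, mul_inv_cancel_left₀ h]

lemma exists_gain_eq [Nonempty a] (hN : IsChannel N) (hU : IsIsometricExtension U N) {l m v : ℝ}
    (hv : v ∈ pureValues U l m) :
    ∃ z ∈ convexHull ℝ (penalty N U l m '' ensembleSet N), v = gain N m z := by
  obtain ⟨r, s, p, ψ, hp, hψ, rfl⟩ := hv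
  choose z hz h using fun x => exists_smul_eq_sum_smul (convex_convexHull ℝ _)
    (ensembleSet_nonempty (N := N)) (hp.1 x)
    fun y => subset_convexHull ℝ _ ⟨ψ x y, hψ x y, rfl⟩
  refine ⟨_, ?_, pureObjective_eq_gain hN hU hp hψ l m
    (fun x => isDensity_of_mem_ensembleSet (hz x)) h⟩
  exact (convex_convexHull ℝ _).sum_mem (fun x _ => Finset.sum_nonneg fun y _ => hp.1 x y) hp.2
    fun x _ => subset_convexHull ℝ _ ⟨z x, hz x, rfl⟩

/-- The outer convex combination supplies the letters of `X`, the inner ones those of `Y`, so every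
point of the double hull comes from a pure ensemble. -/
lemma gain_mem_pureValues (hN : IsChannel N) (hU : IsIsometricExtension U N) {l m : ℝ}
    {z : Matrix a a ℂ × ℝ} (hz : z ∈ convexHull ℝ (penalty N U l m '' ensembleSet N)) :
    gain N m z ∈ pureValues U l m := by
  classical
  obtain ⟨ι, _, w, k, hw, hw1, hk, rfl⟩ := mem_convexHull_iff_exists_fintype.mp hz
  choose c hc hck using hk
  choose κ _ v g hv hv1 hg hgc using fun i => mem_convexHull_iff_exists_fintype.mp (hc i)
  choose ψ hψ' hψg using hg
  have hψ : ∀ i j, IsPure (ψ i j) := hψ'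
  -- The inner combinations have different index types, so `Y` is their disjoint union and `p`
  -- vanishes off the block belonging to `i`.
  let p : ι → (Σ i, κ i) → ℝ := fun i j => if j.1 = i then w i * v j.1 j.2 else 0
  have hp0 : ∀ i j, 0 ≤ p i j := by
    intro i j
    simp only [p]
    split_ifs
    · exact mul_nonneg (hw i) (hv _ _)
    · exact le_rfl
  have hmarg : ∀ i, ∑ j, p i j = w i := by
    intro i
    simp only [p, Fintype.sum_sigma]
    rw [Finset.sum_eq_single i]
    · simp [← Finset.mul_sum, hv1]
    · intro i' _ h; simp [h]
    · simp
  have hp : IsJointDistribution p := ⟨hp0, by simp only [hmarg, hw1]⟩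
  have h : ∀ i, ∑ j, p i j • outputPoint N (ψ j.1 j.2) = (∑ j, p i j) • c i := by
    intro i
    rw [hmarg, Fintype.sum_sigma, ← hgc i, Finset.smul_sum, Finset.sum_eq_single i]
    · exact Finset.sum_congr rfl fun j _ => by simp only [p, if_true, hψg, smul_smul]
    · intro i' _ h; simp [p, h]
    · simp
  have e := pureObjective_eq_gain hN hU hp (ψ := fun _ j => ψ j.1 j.2)
    (fun _ j => hψ j.1 j.2) l m (fun i => isDensity_of_mem_ensembleSet (hc i)) h
  simp only [hmarg, hck] at e
  rw [← e]
  exact pureObjective_mem_pureValues hN hU hp (fun _ j => hψ j.1 j.2) l m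

lemma exists_isGreatest_pureValues [Nonempty a] (hN : IsChannel N)
    (hU : IsIsometricExtension U N) (l m : ℝ) : ∃ g, IsGreatest (pureValues U l m) g := by
  obtain ⟨z, hz, hmax⟩ := exists_isMaxOn_gain hN hU l m
  refine ⟨gain N m z, gain_mem_pureValues hN hU hz, fun v hv => ?_⟩
  obtain ⟨z', hz', rfl⟩ := exists_gain_eq hN hU hv
  exact hmax hz'

end Maximum

end PrivateDynamic

theorem mainTheorem4 {a b e : Type*} [Fintype a] [DecidableEq a] [Nonempty a]
    [Fintype b] [DecidableEq b] [Fintype e] [DecidableEq e]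
    (N : Matrix a a ℂ →ₗ[ℂ] Matrix b b ℂ) (hN : PrivateDynamic.IsChannel N)
    (hdeg : PrivateDynamic.IsDegradable N)
    (U : Matrix (b × e) a ℂ) (hU : PrivateDynamic.IsIsometricExtension U N)
    (l m : ℝ) (hl : 0 ≤ l) (hm : 0 ≤ m) :
    IsGreatest (PrivateDynamic.privateValues U l m) (PrivateDynamic.privateDynamicFormula U l m) ∧
    IsGreatest (PrivateDynamic.pureValues U l m) (PrivateDynamic.pureFormula U l m) ∧
    PrivateDynamic.privateDynamicFormula U l m = PrivateDynamic.pureFormula U l m := by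
  obtain ⟨g, hg⟩ := PrivateDynamic.exists_isGreatest_pureValues hN hU l m
  have hP : IsGreatest (PrivateDynamic.privateValues U l m) g := by
    refine ⟨PrivateDynamic.pureValues_subset_privateValues hN hU l m hg.1, fun v hv => ?_⟩
    obtain ⟨w, hw, hvw⟩ := PrivateDynamic.exists_pureValue_ge hN hdeg hU hl hm hv
    exact hvw.trans (hg.2 hw)
  rw [PrivateDynamic.privateDynamicFormula, PrivateDynamic.pureFormula, hg.csSup_eq, hP.csSup_eq]
  exact ⟨hP, hg, rfl⟩
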